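/- Let $V:\mathbb R^d\to\mathbb R$ be twice continuously differentiable with $\int e^{-V}<\infty$, and let $\pi$ be the probability measure on $\mathbb R^d$ with density proportional to $e^{-V}$. Let $\mathrm{BW}(\mathbb R^d)$ be the set of non-degenerate Gaussian measures $p=\mathcal N(m,\Sigma)$ on $\mathbb R^d$ ($m\in\mathbb R^d$, $\Sigma\succ0$), and assume that $\mathrm{KL}(p\,\|\,\pi)<\infty$ for every $p\in\mathrm{BW}(\mathbb R^d)$. Equip $\mathrm{BW}(\mathbb R^d)\cong\mathbb R^d\times\mathbb S^d_{++}$ with the Riemannian metric induced by the $2$-Wasserstein distance $W_2$: a curve $(m_t,\Sigma_t)$ has tangent vector $(a,S)$, with $a\in\mathbb R^d$ and $S$ a symmetric $d\times d$ matrix, if $\dot m_t=a$ and $\dot\Sigma_t=S\Sigma_t+\Sigma_tS$; and $\langle(a,S),(a',S')\rangle_p=\langle a,a'\rangle+\operatorname{tr}(S\Sigma S')$ at $p=\mathcal N(m,\Sigma)$. A gradient flow of $\mathcal F:\mathrm{BW}(\mathbb R^d)\to\mathbb R$ is a curve $(p_t)_{t\ge0}$ in $\mathrm{BW}(\mathbb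 R^d)$ whose tangent vector at every time $t\ge 0$ is $-\nabla_{\mathrm{BW}}\mathcal F(p_t)$, the negative of the Riemannian gradient of $\mathcal F$ at $p_t$. Suppose that $\nabla^2V\succeq\alpha I$ for some $\alpha\in\mathbb R$. Then, for every $p_0\in\mathrm{BW}(\mathbb R^d)$, there is a unique gradient flow $(p_t)_{t\ge0}$ of $\mathrm{KL}(\cdot\,\|\,\pi)$ on $\mathrm{BW}(\mathbb R^d)$ started at $p_0$. Moreover, for $\hat\pi\in\arg\min_{p\in\mathrm{BW}(\mathbb R^d)}\mathrm{KL}(p\,\|\,\pi)$: 1. If $\alpha>0$, then for all $t\ge0$, $W_2^2(p_t,\hat\pi)\le e^{-2\alpha t}\,W_2^2(p_0,\hat\pi)$. 2. If $\alpha>0$, then for all $t\ge0$, $\mathrm{KL}(p_t\,\|\,\pi)-\mathrm{KL}(\hat\pi\,\|\,\pi)\le e^{-2\alpha t}\,\{\mathrm{KL}(p_0\,\|\,\pi)-\mathrm{KL}(\hat\pi\,\|\,\pi)\}$. 3. If $\alpha=0$, then for all $t>0$, $\mathrm{KL}(p_t\,\|\,\pi)-\mathrm{KL}(\hat\pi\,\|\,\pi)\le\frac1{2t}\,W_2^2(p_0,\hat\pi)$.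 -/

import Mathlib

open MeasureTheory ProbabilityTheory InformationTheory Set
open scoped ENNReal Matrix

noncomputable section

/-- The space `BW(ℝᵈ)` of non-degenerate Gaussians on `ℝᵈ`, identified with
`ℝᵈ × 𝕊₊₊ᵈ` through the mean and the covariance matrix. -/
@[ext]
structure BW (d : ℕ) where
  /-- the mean -/
  mean : EuclideanSpace ℝ (Fin d)
  /-- the covariance matrix -/
  cov : Matrix (Fin d) (Fin d) ℝ
  /-- the covariance matrix is symmetric positive definite -/
  cov_posDef : cov.PosDef

/-- The Gaussian law `𝒩(m, Σ)`, a measure on `ℝᵈ`. -/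
def BW.toMeasure {d : ℕ} (p : BW d) : Measure (EuclideanSpace ℝ (Fin d)) :=
  multivariateGaussian p.mean p.cov

/-- The target law `π ∝ exp (-V)`, i.e. `exp (-V) / ∫ exp (-V)` times Lebesgue measure. -/
def targetMeasure {d : ℕ} (V : EuclideanSpace ℝ (Fin d) → ℝ) :
    Measure (EuclideanSpace ℝ (Fin d)) :=
  volume.tilted (fun x => -V x)

/-- `γ` is a coupling of `μ` and `ν`. -/
def IsCoupling {d : ℕ} (μ ν : Measure (EuclideanSpace ℝ (Fin d)))
    (γ : Measure (EuclideanSpace ℝ (Fin d) × EuclideanSpace ℝ (Fin d))) : Prop :=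
  γ.map Prod.fst = μ ∧ γ.map Prod.snd = ν

/-- The `2`-Wasserstein distance
`W₂(μ, ν) = (inf over couplings γ of ∫ ‖x - y‖² dγ(x, y)) ^ (1/2)`. -/
def W₂ {d : ℕ} (μ ν : Measure (EuclideanSpace ℝ (Fin d))) : ℝ≥0∞ :=
  (⨅ (γ : Measure (EuclideanSpace ℝ (Fin d) × EuclideanSpace ℝ (Fin d)))
    (_ : IsCoupling μ ν γ), ∫⁻ z, ‖z.1 - z.2‖ₑ ^ 2 ∂γ) ^ (1 / 2 : ℝ)

/-- Pairs `(a, S)`; those with `S` symmetric are the tangent vectors to `BW(ℝᵈ)`. At `p`, the pair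
`(a, S)` stands for the affine vector field `x ↦ a + S (x - m_p)`. -/
abbrev TangentPair (d : ℕ) : Type :=
  EuclideanSpace ℝ (Fin d) × Matrix (Fin d) (Fin d) ℝ

/-- The Bures-Wasserstein Riemannian metric
`⟨(a, S), (a', S')⟩_p = ⟨a, a'⟩ + ⟨S, Σ_p S'⟩`. -/
def bwInner {d : ℕ} (p : BW d) (v w : TangentPair d) : ℝ :=
  inner ℝ v.1 w.1 + (v.2ᵀ * (p.cov * w.2)).trace

/-- The curve `p` in `BW(ℝᵈ)` has at time `t` (along the time set `s`) the tangent vector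
`v = (a, S)`, with `S` symmetric: `m' = a` and `Σ' = S Σ + Σ S` (entrywise). -/
def HasBWTangentWithinAt {d : ℕ} (p : ℝ → BW d) (v : TangentPair d) (s : Set ℝ) (t : ℝ) : Prop :=
  v.2.IsSymm ∧
  HasDerivWithinAt (fun τ => (p τ).mean) v.1 s t ∧
  ∀ i j, HasDerivWithinAt (fun τ => (p τ).cov i j)
    ((v.2 * (p t).cov + (p t).cov * v.2) i j) s t

/-- `g` is the Riemannian gradient at `p` of the functional `F` on `BW(ℝᵈ)`: `g` is a tangent
vector, and `∂ₜ F(pₜ) = ⟨g, v⟩_p` at `t = 0` for every curve through `p` at time `0` with tangent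
vector `v` at time `0`. -/
def HasBWGradientAt {d : ℕ} (F : BW d → ℝ) (g : TangentPair d) (p : BW d) : Prop :=
  g.2.IsSymm ∧
  ∀ (q : ℝ → BW d) (v : TangentPair d), q 0 = p → HasBWTangentWithinAt q v univ 0 →
    HasDerivAt (fun t => F (q t)) (bwInner p g v) 0

/-- `(p t)`, `t ≥ 0`, is a gradient flow of `F` on `BW(ℝᵈ)`: at every time `t ≥ 0` the gradient
of `F` at `p t` exists and the tangent vector of the curve is minus this gradient
(one-sided at `t = 0`). The values of `p` at negative times play no role. -/
def IsBWGradientFlow {d : ℕ} (F : BW d → ℝ) (p : ℝ → BW d) : Prop :=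
  ∀ t, 0 ≤ t → ∃ g : TangentPair d,
    HasBWGradientAt F g (p t) ∧ HasBWTangentWithinAt p (-g) (Ici 0) t

/-- The functional `p ↦ KL(p ‖ π)` on `BW(ℝᵈ)`, with `π ∝ exp (-V)`, as a real number
(faithful where the divergence is finite). -/
def klTo {d : ℕ} (V : EuclideanSpace ℝ (Fin d) → ℝ) (p : BW d) : ℝ :=
  (klDiv p.toMeasure (targetMeasure V)).toReal

end

/-!
The divergence `KL(· ‖ π)` is an `α`-convex function on the Bures-Wasserstein manifold, and the
theorem is the standard theory of gradient flows of such functions, carried out by hand.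

*Regularity.* For `p = 𝒩(m, Σ)` one has `KL(p ‖ π) = ∫ V dp - log det Σ / 2 + const` (`klTo_eq`).
The Gaussians are an exponential family, so `∫ V dp` is a quotient of Laplace-type integrals
`∫ exp (θ · T) V`, which are smooth in the parameter `θ` on any open set where they converge, with
no regularity or growth condition on `V` (`contDiffOn_integral_exp_smul`). Hence the divergence has
a smooth extension `extKL` to an open subset of `ℝᵈ × ℝᵈˣᵈ`, its gradient `klGrad` exists and is
unique, and the gradient flow is an ordinary differential equation with a `C¹` right-hand side.

*Existence and uniqueness.* Uniqueness is that of the ODE. For global existence the flow has to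
stay in a compact set on bounded time intervals (`exists_forward_solution`). Since the divergence is
nonnegative and dissipates at the rate of its squared gradient, second moment plus divergence grow
at most exponentially (`flow_bounds`); the quadratic lower bound on `V` and the bound on the
divergence then keep the determinant of the covariance away from zero (`exists_det_lower_bound`).

*Wasserstein distance.* For `A ≻ 0` with `A Σ_p A = Σ_q`, the affine map with linear part `A` gives
a coupling of `p` and `q`, and the quadratic potentials given by `A` and `A⁻¹` are feasible in the
Kantorovich dual with the same value. So `W₂² (p, q)` is the value `dualCost A p q` at this `A`, and
it is at least `dualCost A p q` for every other positive definite `A`.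

*Convexity.* Along the geodesic from `p` to `q` the energy `∫ V dp` satisfies the chord inequality
of an `α`-convex function because `V` does pointwise, and `- log det` is convex
(`klTo_geodesic_le`). Differentiating at `p` gives the tangent inequality `bwInner_klGrad_le`.

*Rates.* Let `F = KL(· ‖ π)`. To differentiate `D(t) = W₂² (p_t, q)` it is enough to have, at each
time `t`, a differentiable function that touches `D` from below at `t`, and `s ↦ dualCost A_t p_s q`
is one; by the tangent inequality its derivative is at most `2 (F(q) - F(p_t)) - α D(t)`
(`IsBWGradientFlow.exists_touching`). At a minimizer `q` this makes `exp (2 α t) D(t)`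
nonincreasing, and for `α = 0` it makes `D(t) + 2 t (F(p_t) - F(q))` nonincreasing. The exponential
decay of `F` is the Polyak-Łojasiewicz inequality with Grönwall's argument.
-/

/-! ### Ordinary differential equations on an open set -/

section ODE

open Filter Topology

variable {E : Type*} [NormedAddCommGroup E] [NormedSpace ℝ E]

theorem HasDerivWithinAt.Ici_of_Icc {y : ℝ → E} {y' : E} {T t : ℝ} (ht : t ∈ Ico 0 T)
    (h : HasDerivWithinAt y y' (Icc 0 T) t) : HasDerivWithinAt y y' (Ici t) t :=
  h.mono_of_mem_nhdsWithin <| mem_of_superset (Icc_mem_nhdsGE ht.2) (Icc_subset_Icc_left ht.1)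

variable [FiniteDimensional ℝ E]

/-- A `C¹` vector field on an open set `U` agrees near a compact subset of `U` with a compactly
supported `C¹` vector field on the whole space. -/
theorem exists_contDiff_cutoff {U K : Set E} (hU : IsOpen U) {v : E → E}
    (hv : ContDiffOn ℝ 1 v U) (hK : IsCompact K) (hKU : K ⊆ U) :
    ∃ w : E → E, ContDiff ℝ 1 w ∧ HasCompactSupport w ∧
      ∃ O, IsOpen O ∧ K ⊆ O ∧ O ⊆ U ∧ EqOn w v O := by
  obtain ⟨K₁, hK₁, hKK₁, hK₁U⟩ := exists_compact_between hK hU hKU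
  obtain ⟨f, hf1, hf0, -⟩ := exists_contMDiffMap_one_nhds_of_subset_interior
    (modelWithCornersSelf ℝ E) (n := 1) hK.isClosed hKK₁
  have hf : ContDiff ℝ 1 f := contMDiff_iff_contDiff.1 f.contMDiff
  refine ⟨fun x => f x • v x, ?_, ?_, ?_⟩
  · refine contDiff_of_contDiffOn_union_of_isOpen (s := U) (t := K₁ᶜ)
      (hf.contDiffOn.smul hv) ?_ ?_ hU hK₁.isClosed.isOpen_compl
    · exact (contDiffOn_const (c := (0 : E))).congr fun x hx => by simp [hf0 x hx]
    · exact eq_univ_of_forall fun x => (em (x ∈ K₁)).imp (fun h => hK₁U h) id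
  · exact HasCompactSupport.intro hK₁ fun x hx => by simp [hf0 x hx]
  · obtain ⟨O, hO, hKO, hO1⟩ := eventually_nhdsSet_iff_exists.1 hf1
    refine ⟨O ∩ U, hO.inter hU, subset_inter hKO hKU, inter_subset_right, fun x hx => ?_⟩
    simp [hO1 x hx.1]

/-- Two solutions of an autonomous ODE with `C¹` right hand side in an open set that start at the
same point coincide. -/
theorem ODE_solution_unique_of_contDiffOn {U : Set E} (hU : IsOpen U) {v : E → E}
    (hv : ContDiffOn ℝ 1 v U) {T : ℝ} {y z : ℝ → E}
    (hy : ∀ t ∈ Icc 0 T, y t ∈ U ∧ HasDerivWithinAt y (v (y t)) (Icc 0 T) t)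
    (hz : ∀ t ∈ Icc 0 T, z t ∈ U ∧ HasDerivWithinAt z (v (z t)) (Icc 0 T) t)
    (h0 : y 0 = z 0) : EqOn y z (Icc 0 T) := by
  have hyc : ContinuousOn y (Icc 0 T) := fun t ht => (hy t ht).2.continuousWithinAt
  have hzc : ContinuousOn z (Icc 0 T) := fun t ht => (hz t ht).2.continuousWithinAt
  obtain ⟨w, hw, hwc, O, -, hKO, -, hwv⟩ := exists_contDiff_cutoff hU hv
    ((isCompact_Icc.image_of_continuousOn hyc).union (isCompact_Icc.image_of_continuousOn hzc))
    (by
      rintro _ (⟨t, ht, rfl⟩ | ⟨t, ht, rfl⟩)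
      exacts [(hy t ht).1, (hz t ht).1])
  obtain ⟨C, hC⟩ := hw.lipschitzWith_of_hasCompactSupport hwc one_ne_zero
  refine ODE_solution_unique (v := fun _ => w) (fun _ => hC) hyc (fun t ht => ?_) hzc
    (fun t ht => ?_) h0
  · have ht' := Ico_subset_Icc_self ht
    rw [hwv (hKO (Or.inl ⟨t, ht', rfl⟩))]
    exact (hy t ht').2.Ici_of_Icc ht
  · have ht' := Ico_subset_Icc_self ht
    rw [hwv (hKO (Or.inr ⟨t, ht', rfl⟩))]
    exact (hz t ht').2.Ici_of_Icc ht

/-- A compactly supported `C¹` vector field has integral curves on every interval `[0, T]`. -/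
theorem exists_solution_of_hasCompactSupport {w : E → E} (hw : ContDiff ℝ 1 w)
    (hwc : HasCompactSupport w) (x₀ : E) {T : ℝ} (hT : 0 ≤ T) :
    ∃ y : ℝ → E, y 0 = x₀ ∧ ∀ t ∈ Icc 0 T, HasDerivWithinAt y (w (y t)) (Icc 0 T) t := by
  obtain ⟨C, hC⟩ := hw.lipschitzWith_of_hasCompactSupport hwc one_ne_zero
  obtain ⟨L, hL⟩ := hwc.exists_bound_of_continuous hw.continuous
  have hPL : IsPicardLindelof (fun _ => w) (tmin := 0) (tmax := T) ⟨0, le_rfl, hT⟩ x₀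
      (L.toNNReal * T.toNNReal) 0 L.toNNReal C := by
    refine IsPicardLindelof.of_time_independent
      (fun x _ => (hL x).trans (Real.le_coe_toNNReal L)) hC.lipschitzOnWith ?_
    simp [hT]
  exact hPL.exists_eq_forall_mem_Icc_hasDerivWithinAt₀

/-- If the solutions of an autonomous ODE started at `x₀` that live in the open set `U` up to time
`T` stay, for every `T`, in a compact subset of `U` depending on `T` only, then there is a solution
for all positive times. -/
theorem exists_forward_solution {U : Set E} (hU : IsOpen U) {v : E → E}
    (hv : ContDiffOn ℝ 1 v U) {x₀ : E}
    (hbound : ∀ T, 0 ≤ T → ∃ K, IsCompact K ∧ K ⊆ U ∧ ∀ T' ∈ Icc 0 T, ∀ y : ℝ → E, y 0 = x₀ →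
      (∀ t ∈ Icc 0 T', y t ∈ U ∧ HasDerivWithinAt y (v (y t)) (Icc 0 T') t) → y T' ∈ K)
    (hx₀ : x₀ ∈ U) :
    ∃ y : ℝ → E, y 0 = x₀ ∧
      ∀ t, 0 ≤ t → y t ∈ U ∧ HasDerivWithinAt y (v (y t)) (Ici 0) t := by
  have key : ∀ T, 0 ≤ T → ∃ y : ℝ → E, y 0 = x₀ ∧
      ∀ t ∈ Icc 0 T, y t ∈ U ∧ HasDerivWithinAt y (v (y t)) (Icc 0 T) t := by
    intro T hT
    obtain ⟨K, hK, hKU, hKb⟩ := hbound T hT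
    obtain ⟨w, hw, hwc, O, hO, hKO, hOU, hwv⟩ := exists_contDiff_cutoff hU hv hK hKU
    obtain ⟨y, hy0, hy⟩ := exists_solution_of_hasCompactSupport hw hwc x₀ hT
    have hyc : ContinuousOn y (Icc 0 T) := fun t ht => (hy t ht).continuousWithinAt
    -- As long as the solution of the cut-off equation is in `O` it solves the original equation,
    -- hence it is in `K`, so it can never leave `K`.
    have step : ∀ T' ∈ Icc 0 T, (∀ t ∈ Icc 0 T', y t ∈ O) → y T' ∈ K := fun T' hT' h =>
      hKb T' hT' y hy0 fun t ht => ⟨hOU (h t ht), by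
        rw [← hwv (h t ht)]
        exact (hy t ⟨ht.1, ht.2.trans hT'.2⟩).mono (Icc_subset_Icc_right hT'.2)⟩
    have h0K : y 0 ∈ K := hKb 0 ⟨le_rfl, hT⟩ y hy0 fun t ht => by
      obtain rfl : t = 0 := le_antisymm ht.2 ht.1
      rw [hy0]
      refine ⟨hx₀, ?_⟩
      rw [Icc_self]
      exact hasDerivWithinAt_iff_hasFDerivWithinAt.2
        (HasFDerivWithinAt.of_subsingleton subsingleton_singleton)
    have hmem : Icc 0 T ⊆ {t | y t ∈ K} := by
      refine IsClosed.Icc_subset_of_forall_mem_nhdsGT_of_Icc_subset ?_ h0K ?_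
      · rw [inter_comm]
        exact hyc.preimage_isClosed_of_isClosed isClosed_Icc hK.isClosed
      · intro t ht htK
        have hev : ∀ᶠ s in 𝓝[≥] t, y s ∈ O ∧ s ≤ T := by
          have h1 : 𝓝[≥] t ≤ 𝓝[Icc 0 T] t := nhdsWithin_le_of_mem
            (mem_of_superset (Icc_mem_nhdsGE ht.2) (Icc_subset_Icc_left ht.1))
          have h2 : ∀ᶠ s in 𝓝[≥] t, y s ∈ O :=
            h1 ((hyc t ⟨ht.1, ht.2.le⟩) (hO.mem_nhds (hKO (htK ⟨ht.1, le_rfl⟩))))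
          refine h2.and ?_
          exact mem_of_superset (Icc_mem_nhdsGE ht.2) fun s hs => hs.2
        obtain ⟨u, hu, hsub⟩ := (mem_nhdsGE_iff_exists_Ico_subset).1 hev
        refine mem_of_superset (Ioo_mem_nhdsGT hu) fun s hs => ?_
        refine step s ⟨ht.1.trans hs.1.le, (hsub ⟨hs.1.le, hs.2⟩).2⟩ fun r hr => ?_
        rcases le_total r t with hrt | hrt
        · exact hKO (htK ⟨hr.1, hrt⟩)
        · exact (hsub ⟨hrt, hr.2.trans_lt hs.2⟩).1
    refine ⟨y, hy0, fun t ht => ⟨hKU (hmem ht), ?_⟩⟩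
    rw [← hwv (hKO (hmem ht))]
    exact hy t ht
  choose! Y hY0 hY using key
  have hEq : ∀ T S, 0 ≤ T → T ≤ S → EqOn (Y T) (Y S) (Icc 0 T) := fun T S hT hTS =>
    ODE_solution_unique_of_contDiffOn hU hv (hY T hT)
      (fun t ht => ⟨(hY S (hT.trans hTS) t ⟨ht.1, ht.2.trans hTS⟩).1,
        (hY S (hT.trans hTS) t ⟨ht.1, ht.2.trans hTS⟩).2.mono (Icc_subset_Icc_right hTS)⟩)
      (by rw [hY0 T hT, hY0 S (hT.trans hTS)])
  refine ⟨fun t => Y t t, hY0 0 le_rfl, fun t ht => ⟨(hY t ht t ⟨ht, le_rfl⟩).1, ?_⟩⟩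
  have hd := (hY (t + 1) (by linarith) t ⟨ht, by linarith⟩).2
  have hloc : ∀ s ∈ Icc 0 (t + 1), Y s s = Y (t + 1) s := fun s hs =>
    hEq s (t + 1) hs.1 hs.2 ⟨hs.1, le_rfl⟩
  have hnhds : Icc 0 (t + 1) ∈ 𝓝[Ici 0] t := by
    rw [← Ici_inter_Iic]
    exact inter_mem self_mem_nhdsWithin (mem_nhdsWithin_of_mem_nhds (Iic_mem_nhds (by linarith)))
  have := (hd.congr hloc (hloc t ⟨ht, by linarith⟩)).mono_of_mem_nhdsWithin hnhds
  rwa [← hloc t ⟨ht, by linarith⟩] at this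

end ODE

/-! ### A monotonicity criterion for functions without derivative -/

section Dini

open Filter Topology

/-- A continuous function on `[0, T]` which, at each point `t` of `(0, T]`, lies to the left of
`t` above a function with nonpositive derivative at `t` touching it at `t`, satisfies
`f T ≤ f 0`. -/
theorem le_of_touching_from_below {f : ℝ → ℝ} {T : ℝ} (hT : 0 ≤ T)
    (hf : ContinuousOn f (Icc 0 T))
    (h : ∀ t ∈ Ioc 0 T, ∃ φ : ℝ → ℝ, ∃ φ' ≤ 0, φ t = f t ∧ (∀ s ∈ Icc 0 t, φ s ≤ f s) ∧
      HasDerivWithinAt φ φ' (Icc 0 t) t) : f T ≤ f 0 := by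
  -- Reversing time turns left difference quotients into right ones.
  have hmaps : MapsTo (fun s => T - s) (Icc 0 T) (Icc 0 T) := fun s hs =>
    ⟨by linarith [hs.2], by linarith [hs.1]⟩
  have hg : ContinuousOn (fun s => -f (T - s)) (Icc 0 T) :=
    (hf.comp (by fun_prop) hmaps).neg
  have := image_le_of_liminf_slope_right_le_deriv_boundary (f := fun s => -f (T - s)) hg
    (B := fun _ => -f T) (B' := fun _ => 0) (by simp) continuousOn_const
    (fun x _ => hasDerivWithinAt_const ..) ?_ (right_mem_Icc.2 hT)
  · simp only [sub_self] at this; linarith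
  intro x hx r hr
  obtain ⟨φ, φ', hφ', hφt, hle, hd⟩ := h (T - x) ⟨by linarith [hx.2], by linarith [hx.1]⟩
  have hd' : HasDerivWithinAt (fun s => -φ (T - s)) φ' (Icc x T) x := by
    have h1 : HasDerivWithinAt (fun s => T - s) (-1) (Icc x T) x :=
      ((hasDerivAt_id x).const_sub T).hasDerivWithinAt
    have h2 := (hd.scomp x h1 (fun s hs => ⟨by linarith [hs.2], by linarith [hs.1]⟩)).neg
    simpa using! h2
  have hd'' : HasDerivWithinAt (fun s => -φ (T - s)) φ' (Ioi x) x :=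
    hd'.mono_of_mem_nhdsWithin (mem_of_superset (Ioo_mem_nhdsGT hx.2) Ioo_subset_Icc_self)
  have hs := (hasDerivWithinAt_iff_tendsto_slope' (by simp)).1 hd''
  have hev := hs.eventually (gt_mem_nhds (hφ'.trans_lt hr))
  refine (hev.and (Ioo_mem_nhdsGT hx.2)).frequently.mono fun z hz => lt_of_le_of_lt ?_ hz.1
  rw [slope_def_field, slope_def_field]
  have hzx : 0 < z - x := by linarith [hz.2.1]
  have := hle (T - z) ⟨by linarith [hz.2.2], by linarith [hz.2.1]⟩
  gcongr ?_ / _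
  rw [hφt]
  linarith

end Dini

/-! ### Smoothness of exponential families -/

section ExpFamily

open Filter Topology

universe u
variable {X : Type*} [MeasurableSpace X] {μ : Measure X}
  {Θ : Type u} [NormedAddCommGroup Θ] [NormedSpace ℝ Θ]
  {F : Type u} [NormedAddCommGroup F] [NormedSpace ℝ F]
  {T : X → Θ →L[ℝ] ℝ} {W : X → F} {U : Set Θ}

theorem aestronglyMeasurable_smulRight (hT : AEStronglyMeasurable T μ)
    (hW : AEStronglyMeasurable W μ) :
    AEStronglyMeasurable (fun x => (T x).smulRight (W x)) μ := by
  have : Continuous fun p : (Θ →L[ℝ] ℝ) × F => p.1.smulRight p.2 :=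
    ((ContinuousLinearMap.smulRightL ℝ Θ F).continuous.comp continuous_fst).clm_apply
      continuous_snd
  exact this.comp_aestronglyMeasurable (hT.prodMk hW)

theorem aestronglyMeasurable_exp_smul (hT : AEStronglyMeasurable T μ)
    (hW : AEStronglyMeasurable W μ) (θ : Θ) :
    AEStronglyMeasurable (fun x => Real.exp (T x θ) • W x) μ :=
  (Real.continuous_exp.comp_aestronglyMeasurable (hT.apply_continuousLinearMap θ)).smul hW

variable [FiniteDimensional ℝ Θ]

/-- The exponential of the norm of a linear form is dominated by the exponentials of finitely many
of its values. -/
theorem exists_finset_exp_norm_le : ∃ S : Finset Θ, ∀ ℓ : Θ →L[ℝ] ℝ,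
    Real.exp ‖ℓ‖ ≤ ∑ v ∈ S, Real.exp (ℓ v) := by
  classical
  obtain ⟨N, -, hNfin, hN⟩ := (isCompact_closedBall (0 : Θ) 1).finite_cover_balls
    (e := 1 / 2) (by norm_num)
  have hnet : ∀ x : Θ, ‖x‖ ≤ 1 → ∃ v ∈ N, ‖x - v‖ < 1 / 2 := fun x hx => by
    simpa [dist_eq_norm] using hN (by simpa using hx)
  refine ⟨hNfin.toFinset.image fun v => (2 : ℝ) • v, fun ℓ => ?_⟩
  set M := ∑ v ∈ hNfin.toFinset.image fun v => (2 : ℝ) • v, Real.exp (ℓ v)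
  have hle : ∀ v ∈ N, Real.exp (2 * ℓ v) ≤ M := fun v hv => by
    have := Finset.single_le_sum (f := fun v => Real.exp (ℓ v)) (fun i _ => (Real.exp_pos _).le)
      (Finset.mem_image_of_mem (fun v => (2 : ℝ) • v) (hNfin.mem_toFinset.2 hv))
    simpa using this
  have hpos : 0 < M := by
    obtain ⟨v, hv, -⟩ := hnet 0 (by simp)
    exact (Real.exp_pos _).trans_le (hle v hv)
  have hlog : ∀ v ∈ N, ℓ v ≤ Real.log M / 2 := fun v hv => by
    have := (Real.le_log_iff_exp_le hpos).2 (hle v hv)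
    linarith
  have hb : ∀ x : Θ, ‖x‖ ≤ 1 → ℓ x ≤ Real.log M / 2 + ‖ℓ‖ / 2 := fun x hx => by
    obtain ⟨v, hv, hxv⟩ := hnet x hx
    have h1 : ℓ (x - v) ≤ ‖ℓ‖ * (1 / 2) :=
      (le_abs_self _).trans ((ℓ.le_opNorm _).trans (by gcongr))
    have h2 := hlog v hv
    rw [map_sub] at h1
    linarith
  have hnorm : ‖ℓ‖ ≤ Real.log M / 2 + ‖ℓ‖ / 2 := by
    refine ContinuousLinearMap.opNorm_le_of_unit_norm ?_ fun x hx => ?_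
    · simpa using hb 0 (by simp)
    · rw [Real.norm_eq_abs, abs_le]
      have := hb (-x) (by simp [hx])
      rw [map_neg] at this
      exact ⟨by linarith, hb x hx.le⟩
  exact (Real.le_log_iff_exp_le hpos).1 (by linarith)

theorem aestronglyMeasurable_of_continuous_apply [TopologicalSpace X] [OpensMeasurableSpace X]
    [SecondCountableTopology X] (hT : ∀ θ, Continuous fun x => T x θ) :
    AEStronglyMeasurable T μ :=
  (continuous_clm_apply.2 hT).aestronglyMeasurable

/-- Near each parameter in an open set of integrability, the derivative of the integrand of an
exponential family is dominated by an integrable function. -/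
theorem exists_bound_exp_smul (hU : IsOpen U)
    (hint : ∀ θ ∈ U, Integrable (fun x => Real.exp (T x θ) • W x) μ) {θ₀ : Θ} (hθ₀ : θ₀ ∈ U) :
    ∃ δ > 0, ∃ b : X → ℝ, Integrable b μ ∧ ∀ x, ∀ θ ∈ Metric.ball θ₀ δ,
      ‖Real.exp (T x θ) • (T x).smulRight (W x)‖ ≤ b x := by
  obtain ⟨S, hS⟩ := exists_finset_exp_norm_le (Θ := Θ)
  have hev : ∀ᶠ δ : ℝ in 𝓝[>] 0, ∀ v ∈ S, θ₀ + (2 * δ) • v ∈ U := by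
    refine (Finset.eventually_all S).2 fun v _ => ?_
    have hc : ContinuousAt (fun δ : ℝ => θ₀ + (2 * δ) • v) 0 := by fun_prop
    exact (hc.eventually (hU.mem_nhds (by simpa using hθ₀))).filter_mono nhdsWithin_le_nhds
  obtain ⟨δ, hδU, hδ : 0 < δ⟩ := (hev.and self_mem_nhdsWithin).exists
  refine ⟨δ, hδ, fun x => δ⁻¹ * ∑ v ∈ S, ‖Real.exp (T x (θ₀ + (2 * δ) • v)) • W x‖,
    (integrable_finsetSum _ fun v hv => (hint _ (hδU v hv)).norm).const_mul _, fun x θ hθ => ?_⟩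
  have h1 : T x θ ≤ T x θ₀ + δ * ‖T x‖ := by
    have := (le_abs_self _).trans ((T x).le_opNorm (θ - θ₀))
    rw [map_sub] at this
    have h2 : ‖T x‖ * ‖θ - θ₀‖ ≤ ‖T x‖ * δ := by
      gcongr
      exact (mem_ball_iff_norm.1 hθ).le
    linarith
  have h2 : Real.exp (2 * δ * ‖T x‖) ≤ ∑ v ∈ S, Real.exp (2 * δ * T x v) := by
    simpa [norm_smul, abs_of_pos hδ] using hS ((2 * δ) • T x)
  have h3 : δ * ‖T x‖ ≤ Real.exp (δ * ‖T x‖) := by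
    linarith [Real.add_one_le_exp (δ * ‖T x‖)]
  calc ‖Real.exp (T x θ) • (T x).smulRight (W x)‖
      = Real.exp (T x θ) * (‖T x‖ * ‖W x‖) := by
        rw [norm_smul, ContinuousLinearMap.norm_smulRight_apply, Real.norm_eq_abs, Real.abs_exp]
    _ = δ⁻¹ * (Real.exp (T x θ) * (δ * ‖T x‖)) * ‖W x‖ := by field_simp
    _ ≤ δ⁻¹ * (Real.exp (T x θ₀ + δ * ‖T x‖) * Real.exp (δ * ‖T x‖)) * ‖W x‖ := by gcongr
    _ = δ⁻¹ * (Real.exp (T x θ₀) * Real.exp (2 * δ * ‖T x‖)) * ‖W x‖ := by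
        rw [← Real.exp_add, ← Real.exp_add]; ring_nf
    _ ≤ δ⁻¹ * (Real.exp (T x θ₀) * ∑ v ∈ S, Real.exp (2 * δ * T x v)) * ‖W x‖ := by gcongr
    _ = δ⁻¹ * ∑ v ∈ S, ‖Real.exp (T x (θ₀ + (2 * δ) • v)) • W x‖ := by
        rw [mul_assoc, Finset.mul_sum, Finset.sum_mul]
        congr 1
        refine Finset.sum_congr rfl fun v _ => ?_
        rw [norm_smul, Real.norm_eq_abs, Real.abs_exp, map_add, map_smul, Real.exp_add,
          smul_eq_mul]

theorem integrable_exp_smul_smulRight (hT : AEStronglyMeasurable T μ)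
    (hW : AEStronglyMeasurable W μ) (hU : IsOpen U)
    (hint : ∀ θ ∈ U, Integrable (fun x => Real.exp (T x θ) • W x) μ) {θ₀ : Θ} (hθ₀ : θ₀ ∈ U) :
    Integrable (fun x => Real.exp (T x θ₀) • (T x).smulRight (W x)) μ := by
  obtain ⟨δ, hδ, b, hb, hle⟩ := exists_bound_exp_smul hU hint hθ₀
  exact hb.mono' (aestronglyMeasurable_exp_smul hT (aestronglyMeasurable_smulRight hT hW) θ₀)
    (Eventually.of_forall fun x => hle x θ₀ (Metric.mem_ball_self hδ))

theorem hasFDerivAt_integral_exp_smul (hT : AEStronglyMeasurable T μ)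
    (hW : AEStronglyMeasurable W μ) (hU : IsOpen U)
    (hint : ∀ θ ∈ U, Integrable (fun x => Real.exp (T x θ) • W x) μ) {θ₀ : Θ} (hθ₀ : θ₀ ∈ U) :
    HasFDerivAt (fun θ => ∫ x, Real.exp (T x θ) • W x ∂μ)
      (∫ x, Real.exp (T x θ₀) • (T x).smulRight (W x) ∂μ) θ₀ := by
  obtain ⟨δ, hδ, b, hb, hle⟩ := exists_bound_exp_smul hU hint hθ₀
  refine hasFDerivAt_integral_of_dominated_of_fderiv_le (Metric.ball_mem_nhds θ₀ hδ)
    (F' := fun θ x => Real.exp (T x θ) • (T x).smulRight (W x))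
    (Eventually.of_forall fun θ => aestronglyMeasurable_exp_smul hT hW θ) (hint θ₀ hθ₀)
    (aestronglyMeasurable_exp_smul hT (aestronglyMeasurable_smulRight hT hW) θ₀)
    (Eventually.of_forall hle) hb (Eventually.of_forall fun x θ _ => ?_)
  have := ((T x).hasFDerivAt (x := θ)).exp.smul_const (W x)
  refine this.congr_fderiv ?_
  ext θ'
  simp [smul_smul]

/-- The integrals of an exponential family depend smoothly on the parameter. -/
theorem contDiffOn_integral_exp_smul (n : ℕ) (hT : AEStronglyMeasurable T μ)
    (hW : AEStronglyMeasurable W μ) (hU : IsOpen U)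
    (hint : ∀ θ ∈ U, Integrable (fun x => Real.exp (T x θ) • W x) μ) :
    ContDiffOn ℝ n (fun θ => ∫ x, Real.exp (T x θ) • W x ∂μ) U := by
  induction n generalizing F with
  | zero =>
    exact contDiffOn_zero.2 fun θ hθ =>
      (hasFDerivAt_integral_exp_smul hT hW hU hint hθ).continuousAt.continuousWithinAt
  | succ n ih =>
    push_cast
    refine (contDiffOn_succ_iff_fderiv_of_isOpen hU).2 ⟨fun θ hθ =>
      (hasFDerivAt_integral_exp_smul hT hW hU hint hθ).differentiableAt.differentiableWithinAt,
      by simp, ?_⟩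
    exact (ih (aestronglyMeasurable_smulRight hT hW) fun θ hθ =>
      integrable_exp_smul_smulRight hT hW hU hint hθ).congr fun θ hθ =>
        (hasFDerivAt_integral_exp_smul hT hW hU hint hθ).fderiv

end ExpFamily

/-! ### Positive matrices -/

section Matrices

open Filter Topology

variable {d : ℕ}

/-- The matrices, not necessarily symmetric, with positive quadratic form. This is an open subset
of the space of all matrices whose symmetric elements are the positive definite matrices. -/
def posForm (d : ℕ) : Set (Matrix (Fin d) (Fin d) ℝ) :=
  {M | ∀ x : Fin d → ℝ, x ≠ 0 → 0 < x ⬝ᵥ M *ᵥ x}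

theorem Matrix.PosDef.mem_posForm {M : Matrix (Fin d) (Fin d) ℝ} (hM : M.PosDef) :
    M ∈ posForm d := fun x hx => by simpa using hM.dotProduct_mulVec_pos hx

theorem posDef_of_mem_posForm {M : Matrix (Fin d) (Fin d) ℝ} (hs : M.IsSymm)
    (hM : M ∈ posForm d) : M.PosDef :=
  Matrix.PosDef.of_dotProduct_mulVec_pos (by simpa [Matrix.IsHermitian] using hs.eq)
    fun x hx => by simpa using hM x hx

theorem Matrix.PosDef.isSymm {M : Matrix (Fin d) (Fin d) ℝ} (hM : M.PosDef) : M.IsSymm := by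
  have h : Mᴴ = M := hM.1
  rwa [Matrix.conjTranspose_eq_transpose_of_trivial] at h

theorem isOpen_posForm : IsOpen (posForm d) := by
  -- It suffices to look at unit vectors, and the unit sphere is compact.
  have hpos : ∀ M : Matrix (Fin d) (Fin d) ℝ, M ∈ posForm d ↔
      ∀ x ∈ Metric.sphere (0 : Fin d → ℝ) 1, 0 < x ⬝ᵥ M *ᵥ x := by
    refine fun M => ⟨fun h x hx => h x (ne_zero_of_mem_unit_sphere ⟨x, hx⟩), fun h x hx => ?_⟩
    have h1 := h (‖x‖⁻¹ • x) (by simp [norm_smul, hx])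
    have h2 : 0 < ‖x‖ := norm_pos_iff.2 hx
    simp only [Matrix.mulVec_smul, smul_dotProduct, dotProduct_smul, smul_eq_mul] at h1
    have h3 := mul_pos (mul_pos h2 h2) h1
    field_simp at h3
    exact h3
  refine isOpen_iff_mem_nhds.2 fun M hM => ?_
  have hc : Continuous fun p : Matrix (Fin d) (Fin d) ℝ × (Fin d → ℝ) => p.2 ⬝ᵥ p.1 *ᵥ p.2 := by
    fun_prop
  have := (isCompact_sphere (0 : Fin d → ℝ) 1).eventually_forall_of_forall_eventually
    (x₀ := M) (P := fun N x => 0 < x ⬝ᵥ N *ᵥ x) fun x hx =>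
      (hc.tendsto (M, x)).eventually (lt_mem_nhds ((hpos M).1 hM x hx))
  exact this.mono fun N hN => (hpos N).2 hN

theorem det_ne_zero_of_mem_posForm {M : Matrix (Fin d) (Fin d) ℝ} (hM : M ∈ posForm d) :
    M.det ≠ 0 := fun h => by
  obtain ⟨x, hx, hMx⟩ := Matrix.exists_mulVec_eq_zero_iff.2 h
  simpa [hMx] using hM x hx

theorem inv_mem_posForm {M : Matrix (Fin d) (Fin d) ℝ} (hM : M ∈ posForm d) :
    M⁻¹ ∈ posForm d := fun x hx => by
  have hu : IsUnit M.det := (det_ne_zero_of_mem_posForm hM).isUnit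
  have hy : M *ᵥ (M⁻¹ *ᵥ x) = x := by
    rw [Matrix.mulVec_mulVec, Matrix.mul_nonsing_inv _ hu, Matrix.one_mulVec]
  have hne : M⁻¹ *ᵥ x ≠ 0 := fun h => hx (by rw [← hy, h, Matrix.mulVec_zero])
  have := hM _ hne
  rwa [hy, dotProduct_comm] at this

attribute [local instance] Matrix.normedAddCommGroup Matrix.normedSpace

theorem contDiff_matrix_apply {n : WithTop ℕ∞} (i j : Fin d) :
    ContDiff ℝ n fun M : Matrix (Fin d) (Fin d) ℝ => M i j :=
  contDiff_apply_apply ..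

theorem contDiffOn_matrix_iff {E : Type*} [NormedAddCommGroup E] [NormedSpace ℝ E]
    {n : WithTop ℕ∞} {f : E → Matrix (Fin d) (Fin d) ℝ} {s : Set E} :
    ContDiffOn ℝ n f s ↔ ∀ i j, ContDiffOn ℝ n (fun x => f x i j) s :=
  contDiffOn_pi.trans (forall_congr' fun _ => contDiffOn_pi)

theorem hasDerivWithinAt_matrix_iff {f : ℝ → Matrix (Fin d) (Fin d) ℝ}
    {f' : Matrix (Fin d) (Fin d) ℝ} {s : Set ℝ} {t : ℝ} :
    HasDerivWithinAt f f' s t ↔ ∀ i j, HasDerivWithinAt (fun x => f x i j) (f' i j) s t :=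
  hasDerivWithinAt_pi.trans (forall_congr' fun _ => hasDerivWithinAt_pi)

theorem contDiff_det {E : Type*} [NormedAddCommGroup E] [NormedSpace ℝ E] {n : WithTop ℕ∞}
    {f : E → Matrix (Fin d) (Fin d) ℝ} (hf : ∀ i j, ContDiff ℝ n fun x => f x i j) :
    ContDiff ℝ n fun x => (f x).det := by
  simp only [Matrix.det_apply']
  exact ContDiff.sum fun σ _ => contDiff_const.mul (contDiff_prod fun i _ => hf _ _)

theorem contDiffOn_matrix_inv {n : WithTop ℕ∞} :
    ContDiffOn ℝ n (fun M : Matrix (Fin d) (Fin d) ℝ => M⁻¹) (posForm d) := by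
  refine contDiffOn_matrix_iff.2 fun i j => ?_
  simp only [Matrix.inv_def, Ring.inverse_eq_inv', Matrix.smul_apply, smul_eq_mul,
    Matrix.adjugate_apply]
  refine ContDiffOn.mul ?_ (ContDiff.contDiffOn (contDiff_det
    (f := fun M : Matrix (Fin d) (Fin d) ℝ => M.updateRow j (Pi.single i 1)) fun k l => ?_))
  · exact (contDiff_det (f := id) contDiff_matrix_apply).contDiffOn.inv
      fun M hM => det_ne_zero_of_mem_posForm hM
  · simp only [Matrix.updateRow_apply]
    split_ifs
    · exact contDiff_const
    · exact contDiff_matrix_apply k l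

theorem Matrix.PosSemidef.exists_posSemidef_sq {M : Matrix (Fin d) (Fin d) ℝ}
    (hM : M.PosSemidef) : ∃ R : Matrix (Fin d) (Fin d) ℝ, R.PosSemidef ∧ R * R = M := by
  open scoped MatrixOrder in
  exact ⟨CFC.sqrt M, Matrix.nonneg_iff_posSemidef.1 (CFC.sqrt_nonneg M),
    CFC.sqrt_mul_sqrt_self M hM.nonneg⟩

theorem Matrix.PosDef.exists_posDef_sq {M : Matrix (Fin d) (Fin d) ℝ} (hM : M.PosDef) :
    ∃ R : Matrix (Fin d) (Fin d) ℝ, R.PosDef ∧ R * R = M := by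
  obtain ⟨R, hR, rfl⟩ := hM.posSemidef.exists_posSemidef_sq
  refine ⟨R, hR.posDef_iff_det_ne_zero.2 fun h => hM.det_pos.ne' ?_, rfl⟩
  rw [Matrix.det_mul, h, zero_mul]

/-- Between two centred non-degenerate Gaussians with covariances `M` and `N` there is a linear
transport map with positive definite matrix. -/
theorem exists_posDef_transport {M N : Matrix (Fin d) (Fin d) ℝ} (hM : M.PosDef) (hN : N.PosDef) :
    ∃ A : Matrix (Fin d) (Fin d) ℝ, A.PosDef ∧ A * M * A = N := by
  obtain ⟨R, hR, rfl⟩ := hM.exists_posDef_sq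
  have hRu : IsUnit R.det := hR.det_pos.ne'.isUnit
  have hRNR : (R * N * R).PosDef := by
    simpa [hR.isSymm.eq] using hN.conjTranspose_mul_mul_same (B := R)
      (Matrix.mulVec_injective_iff_isUnit.2 hR.isUnit)
  obtain ⟨Q, hQ, hQ2⟩ := hRNR.exists_posDef_sq
  refine ⟨R⁻¹ * Q * R⁻¹, ?_, ?_⟩
  · simpa [hR.inv.isSymm.eq] using hQ.conjTranspose_mul_mul_same (B := R⁻¹)
      (Matrix.mulVec_injective_iff_isUnit.2 hR.inv.isUnit)
  · calc R⁻¹ * Q * R⁻¹ * (R * R) * (R⁻¹ * Q * R⁻¹)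
        = R⁻¹ * Q * (R⁻¹ * R) * (R * R⁻¹) * Q * R⁻¹ := by simp only [mul_assoc]
      _ = R⁻¹ * (Q * Q) * R⁻¹ := by
        rw [Matrix.nonsing_inv_mul _ hRu, Matrix.mul_nonsing_inv _ hRu]
        simp only [mul_assoc, one_mul]
      _ = (R⁻¹ * R) * N * (R * R⁻¹) := by rw [hQ2]; simp only [mul_assoc]
      _ = N := by rw [Matrix.nonsing_inv_mul _ hRu, Matrix.mul_nonsing_inv _ hRu, one_mul, mul_one]

theorem trace_mul_nonneg {M N : Matrix (Fin d) (Fin d) ℝ} (hM : M.PosSemidef)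
    (hN : N.PosSemidef) : 0 ≤ (M * N).trace := by
  obtain ⟨R, hR, rfl⟩ := hM.exists_posSemidef_sq
  rw [mul_assoc, Matrix.trace_mul_comm]
  have h : Rᴴ = R := hR.1
  have := (hN.mul_mul_conjTranspose_same R).trace_nonneg
  rwa [h] at this

theorem abs_apply_le_trace {M : Matrix (Fin d) (Fin d) ℝ} (hM : M.PosSemidef) (i j : Fin d) :
    |M i j| ≤ M.trace := by
  obtain ⟨R, hR, rfl⟩ := hM.exists_posSemidef_sq
  have hs : ∀ a b, R a b = R b a := fun a b => by
    have h : Rᴴ = R := hR.1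
    simpa using (congrFun₂ h b a)
  have htr : (R * R).trace = ∑ a, ∑ k, R a k ^ 2 := by
    simp only [Matrix.trace, Matrix.diag, Matrix.mul_apply]
    exact Finset.sum_congr rfl fun a _ => Finset.sum_congr rfl fun k _ => by rw [hs k a, sq]
  have hrow : ∀ a, ∑ k, R a k ^ 2 ≤ (R * R).trace := fun a => by
    rw [htr]
    exact Finset.single_le_sum (f := fun a => ∑ k, R a k ^ 2)
      (fun i _ => Finset.sum_nonneg fun k _ => sq_nonneg _) (Finset.mem_univ a)
  calc |(R * R) i j| ≤ ∑ k, |R i k * R k j| := by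
        rw [Matrix.mul_apply]; exact Finset.abs_sum_le_sum_abs _ _
    _ ≤ ∑ k, (R i k ^ 2 + R j k ^ 2) / 2 := Finset.sum_le_sum fun k _ => by
        rw [abs_mul, hs k j]
        nlinarith [sq_nonneg (|R i k| - |R j k|), sq_abs (R i k), sq_abs (R j k)]
    _ = ((∑ k, R i k ^ 2) + ∑ k, R j k ^ 2) / 2 := by
        rw [← Finset.sum_div, Finset.sum_add_distrib]
    _ ≤ (R * R).trace := by linarith [hrow i, hrow j]

theorem posDef_one_add_smul_sub_one {A : Matrix (Fin d) (Fin d) ℝ} (hA : A.PosDef) {s : ℝ}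
    (hs : s ∈ Icc (0 : ℝ) 1) : (1 + s • (A - 1)).PosDef := by
  have h : 1 + s • (A - 1) = (1 - s) • (1 : Matrix (Fin d) (Fin d) ℝ) + s • A := by
    rw [smul_sub, sub_smul, one_smul]; abel
  rw [h]
  rcases hs.1.eq_or_lt with rfl | h0
  · simpa using Matrix.PosDef.one
  · exact Matrix.PosDef.posSemidef_add (Matrix.PosSemidef.one.smul (by linarith [hs.2]))
      (hA.smul h0)

/-- Concavity of the logarithm of the determinant along the segment from `1` to `A`. -/
theorem mul_log_det_le {A : Matrix (Fin d) (Fin d) ℝ} (hA : A.PosDef) {s : ℝ}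
    (hs : s ∈ Icc (0 : ℝ) 1) : s * Real.log A.det ≤ Real.log (1 + s • (A - 1)).det := by
  set ev := hA.1.eigenvalues
  set Q : Matrix (Fin d) (Fin d) ℝ := (hA.1.eigenvectorUnitary : Matrix (Fin d) (Fin d) ℝ)
  have hQ : Q * star Q = 1 := Unitary.coe_mul_star_self hA.1.eigenvectorUnitary
  have hspec : A = Q * Matrix.diagonal ev * star Q := by
    have := hA.1.spectral_theorem
    simpa [Unitary.conjStarAlgAut_apply] using this
  have hdet : (1 + s • (A - 1)).det = ∏ i, (1 + s * (ev i - 1)) := by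
    have h1 : 1 + s • (A - 1) = Q * Matrix.diagonal (fun i => 1 + s * (ev i - 1)) * star Q := by
      have h2 : Matrix.diagonal (fun i => 1 + s * (ev i - 1)) =
          1 + s • (Matrix.diagonal ev - 1) := by
        rw [← Matrix.diagonal_one, Matrix.diagonal_sub, ← Matrix.diagonal_smul,
          Matrix.diagonal_add]
        rfl
      rw [h2, mul_add, add_mul, mul_one, hQ, Matrix.mul_smul, Matrix.smul_mul, mul_sub, sub_mul,
        mul_one, hQ, ← hspec]
    rw [h1, Matrix.det_mul, Matrix.det_mul, Matrix.det_diagonal, mul_comm Q.det, mul_assoc,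
      ← Matrix.det_mul, hQ, Matrix.det_one, mul_one]
  have hdetA : A.det = ∏ i, ev i := by simpa using hA.1.det_eq_prod_eigenvalues
  have hpos : ∀ i, 0 < ev i := hA.eigenvalues_pos
  have hpos' : ∀ i, 0 < 1 + s * (ev i - 1) := fun i => by
    rcases hs.1.eq_or_lt with rfl | h0
    · simp
    · nlinarith [hpos i, hs.2, mul_pos h0 (hpos i)]
  rw [hdet, hdetA, Real.log_prod fun i _ => (hpos i).ne', Real.log_prod fun i _ => (hpos' i).ne',
    Finset.mul_sum]
  refine Finset.sum_le_sum fun i _ => ?_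
  have := strictConcaveOn_log_Ioi.concaveOn.2 (mem_Ioi.2 zero_lt_one) (mem_Ioi.2 (hpos i))
    (sub_nonneg.2 hs.2) hs.1 (by ring)
  simp only [smul_eq_mul, Real.log_one, mul_zero, zero_add] at this
  refine this.trans (le_of_eq ?_)
  congr 1
  ring

end Matrices

/-! ### Gaussian measures: moments, affine images, densities -/

section Gaussian

open Filter Topology

variable {d : ℕ}

/-- The linear endomorphism of `ℝᵈ` with matrix `M`. -/
noncomputable abbrev matCLM (M : Matrix (Fin d) (Fin d) ℝ) :
    EuclideanSpace ℝ (Fin d) →L[ℝ] EuclideanSpace ℝ (Fin d) :=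
  Matrix.toEuclideanCLM (𝕜 := ℝ) M

theorem matCLM_mul_apply (M N : Matrix (Fin d) (Fin d) ℝ) (x : EuclideanSpace ℝ (Fin d)) :
    matCLM (M * N) x = matCLM M (matCLM N x) := by
  rw [matCLM, map_mul]; rfl

theorem inner_matCLM (M : Matrix (Fin d) (Fin d) ℝ) (x y : EuclideanSpace ℝ (Fin d)) :
    inner ℝ x (matCLM M y) = ∑ i, ∑ j, M i j * (x i * y j) := by
  rw [Matrix.inner_toEuclideanCLM]
  simp only [dotProduct, Matrix.mulVec, Finset.mul_sum]
  exact Finset.sum_congr rfl fun i _ => Finset.sum_congr rfl fun j _ => by ring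

theorem inner_matCLM_left (M : Matrix (Fin d) (Fin d) ℝ) (x y : EuclideanSpace ℝ (Fin d)) :
    inner ℝ (matCLM M x) y = inner ℝ x (matCLM Mᵀ y) := by
  rw [real_inner_comm, inner_matCLM, inner_matCLM, Finset.sum_comm]
  simp only [Matrix.transpose_apply, mul_comm (y.ofLp _)]

instance BW.isGaussian_toMeasure (p : BW d) : IsGaussian p.toMeasure :=
  inferInstanceAs (IsGaussian (multivariateGaussian _ _))

theorem BW.memLp_two (p : BW d) : MemLp (fun x => x) 2 p.toMeasure :=
  IsGaussian.memLp_two_id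

theorem BW.integral_apply (p : BW d) (i : Fin d) : ∫ x, x i ∂p.toMeasure = p.mean i := by
  have h := integral_id_multivariateGaussian (μ := p.mean) (S := p.cov)
  have h2 := (EuclideanSpace.proj (𝕜 := ℝ) i).integral_comp_comm
    (IsGaussian.integrable_id (μ := p.toMeasure))
  simpa [BW.toMeasure, h] using h2

theorem BW.memLp_apply_sub (p : BW d) (i : Fin d) :
    MemLp (fun x : EuclideanSpace ℝ (Fin d) => x i - p.mean i) 2 p.toMeasure :=
  (p.memLp_two.eval_piLp i).sub (memLp_const _)

theorem BW.integrable_inner_matCLM (p : BW d) (M : Matrix (Fin d) (Fin d) ℝ) :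
    Integrable (fun x => inner ℝ (x - p.mean) (matCLM M (x - p.mean))) p.toMeasure := by
  simp only [inner_matCLM]
  exact integrable_finsetSum _ fun i _ => integrable_finsetSum _ fun j _ =>
    ((p.memLp_apply_sub i).integrable_mul (p.memLp_apply_sub j)).const_mul _

theorem BW.integral_inner_matCLM (p : BW d) (M : Matrix (Fin d) (Fin d) ℝ) :
    ∫ x, inner ℝ (x - p.mean) (matCLM M (x - p.mean)) ∂p.toMeasure = (M * p.cov).trace := by
  have hc : ∀ i j, ∫ x : EuclideanSpace ℝ (Fin d), (x i - p.mean i) * (x j - p.mean j)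
      ∂p.toMeasure = p.cov i j := fun i j => by
    have := covariance_eval_multivariateGaussian (μ := p.mean) p.cov_posDef.posSemidef i j
    have hm := p.integral_apply
    rw [BW.toMeasure] at hm ⊢
    simpa only [covariance, hm] using this
  have hint : ∀ i j, Integrable (fun x : EuclideanSpace ℝ (Fin d) =>
      M i j * ((x i - p.mean i) * (x j - p.mean j))) p.toMeasure := fun i j =>
    ((p.memLp_apply_sub i).integrable_mul (p.memLp_apply_sub j)).const_mul _
  simp only [inner_matCLM, PiLp.sub_apply]
  rw [integral_finsetSum _ fun i _ => integrable_finsetSum _ fun j _ => hint i j]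
  simp only [Matrix.trace, Matrix.diag, Matrix.mul_apply]
  refine Finset.sum_congr rfl fun i _ => ?_
  rw [integral_finsetSum _ fun j _ => hint i j]
  refine Finset.sum_congr rfl fun j _ => ?_
  rw [integral_const_mul, hc]
  congr 1
  exact (p.cov_posDef.isSymm.apply i j).symm

theorem BW.integrable_sub_mean (p : BW d) : Integrable (fun x => x - p.mean) p.toMeasure :=
  (p.memLp_two.integrable one_le_two).sub (integrable_const _)

theorem BW.integral_sub_mean (p : BW d) : ∫ x, (x - p.mean) ∂p.toMeasure = 0 := by
  rw [integral_sub (p.memLp_two.integrable one_le_two) (integrable_const _)]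
  have h := integral_id_multivariateGaussian (μ := p.mean) (S := p.cov)
  simp only [BW.toMeasure] at h ⊢
  simp [h]

theorem BW.integrable_inner_sub_mean (p : BW d) (a : EuclideanSpace ℝ (Fin d)) :
    Integrable (fun x => inner ℝ a (x - p.mean)) p.toMeasure :=
  p.integrable_sub_mean.const_inner a

theorem BW.integral_inner_sub_mean (p : BW d) (a : EuclideanSpace ℝ (Fin d)) :
    ∫ x, inner ℝ a (x - p.mean) ∂p.toMeasure = 0 := by
  rw [integral_inner p.integrable_sub_mean, p.integral_sub_mean, inner_zero_right]

theorem norm_add_matCLM_sq (a y : EuclideanSpace ℝ (Fin d)) (S : Matrix (Fin d) (Fin d) ℝ) :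
    ‖a + matCLM S y‖ ^ 2 =
      ‖a‖ ^ 2 + 2 * inner ℝ (matCLM Sᵀ a) y + inner ℝ y (matCLM (Sᵀ * S) y) := by
  rw [norm_add_sq_real, ← real_inner_self_eq_norm_sq (matCLM S y), matCLM_mul_apply,
    inner_matCLM_left S, inner_matCLM_left Sᵀ, Matrix.transpose_transpose]

theorem BW.integrable_norm_affine_sq (p : BW d) (a : EuclideanSpace ℝ (Fin d))
    (S : Matrix (Fin d) (Fin d) ℝ) :
    Integrable (fun x => ‖a + matCLM S (x - p.mean)‖ ^ 2) p.toMeasure := by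
  simp only [norm_add_matCLM_sq]
  exact ((integrable_const _).add ((p.integrable_inner_sub_mean _).const_mul 2)).add
    (p.integrable_inner_matCLM _)

theorem BW.integral_norm_affine_sq (p : BW d) (a : EuclideanSpace ℝ (Fin d))
    (S : Matrix (Fin d) (Fin d) ℝ) :
    ∫ x, ‖a + matCLM S (x - p.mean)‖ ^ 2 ∂p.toMeasure =
      ‖a‖ ^ 2 + (Sᵀ * S * p.cov).trace := by
  have h : Integrable (fun x => ‖a‖ ^ 2 + 2 * inner ℝ (matCLM Sᵀ a) (x - p.mean)) p.toMeasure :=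
    (integrable_const _).add ((p.integrable_inner_sub_mean _).const_mul 2)
  simp only [norm_add_matCLM_sq]
  rw [integral_add h (p.integrable_inner_matCLM _), integral_add (integrable_const _)
    ((p.integrable_inner_sub_mean _).const_mul 2), integral_const_mul,
    p.integral_inner_sub_mean, p.integral_inner_matCLM]
  simp

/-- The image of a Gaussian under an affine map. -/
theorem BW.map_affine (p q : BW d) (A : Matrix (Fin d) (Fin d) ℝ)
    (h : A * p.cov * Aᵀ = q.cov) :
    p.toMeasure.map (fun x => q.mean + matCLM A (x - p.mean)) = q.toMeasure := by
  have hm : Measurable fun x : EuclideanSpace ℝ (Fin d) => q.mean + matCLM A (x - p.mean) := by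
    fun_prop
  have : IsProbabilityMeasure (p.toMeasure.map fun x => q.mean + matCLM A (x - p.mean)) :=
    Measure.isProbabilityMeasure_map hm.aemeasurable
  refine Measure.ext_of_charFun (funext fun t => ?_)
  have h1 : ∀ x, (inner ℝ (q.mean + matCLM A (x - p.mean)) t : ℝ) =
      inner ℝ x (matCLM Aᵀ t) + (inner ℝ q.mean t - inner ℝ p.mean (matCLM Aᵀ t)) := fun x => by
    rw [inner_add_left, inner_matCLM_left, inner_sub_left]; ring
  have h2 := charFun_multivariateGaussian (μ := p.mean) p.cov_posDef.posSemidef (matCLM Aᵀ t)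
  have h3 := charFun_multivariateGaussian (μ := q.mean) q.cov_posDef.posSemidef t
  have h4 : (matCLM Aᵀ t).ofLp ⬝ᵥ p.cov *ᵥ (matCLM Aᵀ t).ofLp = t.ofLp ⬝ᵥ q.cov *ᵥ t.ofLp := by
    rw [← Matrix.inner_toEuclideanCLM, ← Matrix.inner_toEuclideanCLM, ← h]
    change inner ℝ (matCLM _ _) (matCLM _ _) = inner ℝ _ (matCLM _ _)
    rw [matCLM_mul_apply, matCLM_mul_apply, inner_matCLM_left, Matrix.transpose_transpose]
  rw [charFun_apply, integral_map hm.aemeasurable (by fun_prop)]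
  simp only [h1, Complex.ofReal_add, add_mul, Complex.exp_add]
  rw [integral_mul_const, ← charFun_apply]
  change charFun (multivariateGaussian p.mean p.cov) _ * _ = charFun (multivariateGaussian _ _) _
  rw [h2, h3, h4, ← Complex.exp_add]
  congr 1
  rw [real_inner_comm p.mean, real_inner_comm t q.mean]
  push_cast
  ring

theorem det_matCLM (M : Matrix (Fin d) (Fin d) ℝ) : (matCLM M).det = M.det := by
  rw [ContinuousLinearMap.det, Matrix.coe_toEuclideanCLM_eq_toEuclideanLin,
    Matrix.toEuclideanLin, Matrix.toLpLin_eq_toLin, LinearMap.det_toLin]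

theorem range_add_matCLM (m : EuclideanSpace ℝ (Fin d)) {R : Matrix (Fin d) (Fin d) ℝ}
    (hR : R.det ≠ 0) : (fun x => m + matCLM R x) '' univ = univ := by
  refine eq_univ_of_forall fun y => ⟨matCLM R⁻¹ (y - m), mem_univ _, ?_⟩
  change m + matCLM R (matCLM R⁻¹ (y - m)) = y
  rw [← matCLM_mul_apply, Matrix.mul_nonsing_inv _ hR.isUnit, matCLM, map_one]
  simp

theorem injective_add_matCLM (m : EuclideanSpace ℝ (Fin d)) {R : Matrix (Fin d) (Fin d) ℝ}
    (hR : R.det ≠ 0) : Function.Injective fun x => m + matCLM R x := by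
  refine Function.LeftInverse.injective (g := fun y => matCLM R⁻¹ (y - m)) fun x => ?_
  change matCLM R⁻¹ (m + matCLM R x - m) = x
  rw [add_sub_cancel_left, ← matCLM_mul_apply, Matrix.nonsing_inv_mul _ hR.isUnit, matCLM,
    map_one]
  simp

theorem hasFDerivWithinAt_add_matCLM (m x : EuclideanSpace ℝ (Fin d))
    (R : Matrix (Fin d) (Fin d) ℝ) :
    HasFDerivWithinAt (fun x => m + matCLM R x) (matCLM R) univ x :=
  ((matCLM R).hasFDerivAt.const_add m).hasFDerivWithinAt

variable {F : Type*} [NormedAddCommGroup F] [NormedSpace ℝ F]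

theorem integral_eq_det_smul_integral_affine (m : EuclideanSpace ℝ (Fin d))
    {R : Matrix (Fin d) (Fin d) ℝ} (hR : R.det ≠ 0) (f : EuclideanSpace ℝ (Fin d) → F) :
    ∫ y, f y = |R.det| • ∫ x, f (m + matCLM R x) := by
  have := integral_image_eq_integral_abs_det_fderiv_smul volume MeasurableSet.univ
    (fun x _ => hasFDerivWithinAt_add_matCLM m x R) (injective_add_matCLM m hR).injOn f
  rw [range_add_matCLM m hR] at this
  simpa [det_matCLM, integral_smul] using this

theorem integrable_iff_integrable_affine (m : EuclideanSpace ℝ (Fin d))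
    {R : Matrix (Fin d) (Fin d) ℝ} (hR : R.det ≠ 0) (f : EuclideanSpace ℝ (Fin d) → F) :
    Integrable f ↔ Integrable fun x => f (m + matCLM R x) := by
  have := integrableOn_image_iff_integrableOn_abs_det_fderiv_smul volume MeasurableSet.univ
    (fun x _ => hasFDerivWithinAt_add_matCLM m x R) (injective_add_matCLM m hR).injOn f
  rw [range_add_matCLM m hR] at this
  simp only [integrableOn_univ, det_matCLM] at this
  rw [this, integrable_fun_smul_iff]
  simpa using hR

/-- The exponent `-(x - m) · Σ⁻¹ (x - m) / 2` of the density of `𝒩(m, Σ)`. -/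
noncomputable def BW.logDensity (p : BW d) (x : EuclideanSpace ℝ (Fin d)) : ℝ :=
  -(1 / 2) * inner ℝ (x - p.mean) (matCLM p.cov⁻¹ (x - p.mean))

theorem BW.logDensity_affine (p : BW d) {R : Matrix (Fin d) (Fin d) ℝ} (hR : R.PosDef)
    (hRR : R * R = p.cov) (x : EuclideanSpace ℝ (Fin d)) :
    p.logDensity (p.mean + matCLM R x) = -(1 / 2) * ‖x‖ ^ 2 := by
  have hu : IsUnit R.det := hR.det_pos.ne'.isUnit
  have h1 : R * p.cov⁻¹ * R = 1 := by
    rw [← hRR, Matrix.mul_inv_rev]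
    calc R * (R⁻¹ * R⁻¹) * R = (R * R⁻¹) * (R⁻¹ * R) := by simp only [mul_assoc]
      _ = 1 := by rw [Matrix.mul_nonsing_inv _ hu, Matrix.nonsing_inv_mul _ hu, one_mul]
  rw [BW.logDensity, add_sub_cancel_left, inner_matCLM_left, hR.isSymm.eq, ← matCLM_mul_apply,
    ← matCLM_mul_apply, h1, matCLM, map_one, one_apply_eq_self,
    real_inner_self_eq_norm_sq]

theorem integral_exp_neg_half_norm_sq :
    ∫ x : EuclideanSpace ℝ (Fin d), Real.exp (-(1 / 2) * ‖x‖ ^ 2) =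
      (2 * Real.pi) ^ ((d : ℝ) / 2) := by
  have := GaussianFourier.integral_rexp_neg_mul_sq_norm (V := EuclideanSpace ℝ (Fin d))
    (b := 1 / 2) (by norm_num)
  rw [this, finrank_euclideanSpace_fin]
  congr 1
  ring

theorem BW.integrable_exp_logDensity (p : BW d) :
    Integrable fun x => Real.exp (p.logDensity x) := by
  obtain ⟨R, hR, hRR⟩ := p.cov_posDef.exists_posDef_sq
  rw [integrable_iff_integrable_affine p.mean hR.det_pos.ne']
  simp only [p.logDensity_affine hR hRR]
  by_contra h
  have h1 := integral_undef h
  rw [integral_exp_neg_half_norm_sq] at h1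
  have : 0 < (2 * Real.pi) ^ ((d : ℝ) / 2) := by positivity
  exact this.ne' h1

/-- The normalizing constant of the density of a Gaussian. -/
theorem BW.integral_exp_logDensity (p : BW d) :
    ∫ x, Real.exp (p.logDensity x) = √p.cov.det * (2 * Real.pi) ^ ((d : ℝ) / 2) := by
  obtain ⟨R, hR, hRR⟩ := p.cov_posDef.exists_posDef_sq
  rw [integral_eq_det_smul_integral_affine p.mean hR.det_pos.ne']
  simp only [p.logDensity_affine hR hRR]
  rw [integral_exp_neg_half_norm_sq, ← hRR, Matrix.det_mul, Real.sqrt_mul_self hR.det_pos.le,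
    abs_of_pos hR.det_pos, smul_eq_mul]

/-- The Lebesgue density of a Gaussian, by comparison of characteristic functions. -/
theorem BW.toMeasure_eq_tilted (p : BW d) : p.toMeasure = volume.tilted p.logDensity := by
  obtain ⟨R, hR, hRR⟩ := p.cov_posDef.exists_posDef_sq
  have := isProbabilityMeasure_tilted p.integrable_exp_logDensity
  refine Measure.ext_of_charFun (funext fun t => ?_)
  change charFun (multivariateGaussian p.mean p.cov) t = _
  rw [charFun_multivariateGaussian p.cov_posDef.posSemidef, charFun_apply, integral_tilted]
  have h1 : ∀ x, (Real.exp (p.logDensity x) / ∫ x, Real.exp (p.logDensity x)) •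
      Complex.exp ((inner ℝ x t : ℝ) * Complex.I) =
      ((∫ x, Real.exp (p.logDensity x) : ℝ) : ℂ)⁻¹ *
        (Complex.exp (p.logDensity x + (inner ℝ x t : ℝ) * Complex.I)) := fun x => by
    rw [Complex.real_smul, Complex.exp_add, Complex.ofReal_div, Complex.ofReal_exp]
    ring
  simp only [h1]
  rw [integral_const_mul, p.integral_exp_logDensity,
    integral_eq_det_smul_integral_affine p.mean hR.det_pos.ne']
  simp only [p.logDensity_affine hR hRR]
  have h2 : ∀ x, Complex.exp (((-(1 / 2) * ‖x‖ ^ 2 : ℝ) : ℂ) +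
      (inner ℝ (p.mean + matCLM R x) t : ℝ) * Complex.I) =
      Complex.exp ((inner ℝ t p.mean : ℝ) * Complex.I) *
        Complex.exp (-(1 / 2 : ℂ) * (‖x‖ : ℂ) ^ 2 +
          Complex.I * (inner ℝ (matCLM R t) x : ℝ)) := fun x => by
    rw [← Complex.exp_add]
    congr 1
    rw [inner_add_left, inner_matCLM_left, hR.isSymm.eq, real_inner_comm p.mean,
      real_inner_comm x]
    push_cast
    ring
  simp only [h2]
  rw [integral_const_mul, GaussianFourier.integral_cexp_neg_mul_sq_norm_add (by norm_num),
    finrank_euclideanSpace_fin]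
  have h3 : ((Real.pi : ℂ) / (1 / 2)) ^ ((d : ℂ) / 2) =
      (((2 * Real.pi) ^ ((d : ℝ) / 2) : ℝ) : ℂ) := by
    rw [Complex.ofReal_cpow (by positivity)]
    push_cast
    congr 1
    ring
  have h4 : ‖matCLM R t‖ ^ 2 = t.ofLp ⬝ᵥ p.cov *ᵥ t.ofLp := by
    rw [← Matrix.inner_toEuclideanCLM, ← hRR]
    change _ = inner ℝ _ (matCLM _ _)
    rw [matCLM_mul_apply, ← real_inner_self_eq_norm_sq, inner_matCLM_left, hR.isSymm.eq]
  have h5 : √p.cov.det = R.det := by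
    rw [← hRR, Matrix.det_mul, Real.sqrt_mul_self hR.det_pos.le]
  have h6 : ((R.det : ℝ) : ℂ) ≠ 0 := by exact_mod_cast hR.det_pos.ne'
  have h7 : (((2 * Real.pi) ^ ((d : ℝ) / 2) : ℝ) : ℂ) ≠ 0 := by
    have : 0 < (2 * Real.pi) ^ ((d : ℝ) / 2) := by positivity
    exact_mod_cast this.ne'
  rw [h3, h5, abs_of_pos hR.det_pos, Complex.real_smul, ← Complex.ofReal_pow, h4,
    Complex.I_sq, Complex.ofReal_mul]
  field_simp
  rw [← Complex.exp_add]
  congr 1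
  ring

end Gaussian

/-! ### The Wasserstein distance between Gaussians -/

section Wasserstein

open Filter Topology

variable {d : ℕ}

theorem W₂_sq (μ ν : Measure (EuclideanSpace ℝ (Fin d))) :
    W₂ μ ν ^ 2 = ⨅ (γ : Measure (EuclideanSpace ℝ (Fin d) × EuclideanSpace ℝ (Fin d)))
      (_ : IsCoupling μ ν γ), ∫⁻ z, ‖z.1 - z.2‖ₑ ^ 2 ∂γ := by
  rw [W₂, ← ENNReal.rpow_natCast, ← ENNReal.rpow_mul]
  norm_num

theorem enorm_sq_eq_ofReal {E : Type*} [NormedAddCommGroup E] (x : E) :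
    ‖x‖ₑ ^ 2 = ENNReal.ofReal (‖x‖ ^ 2) := by
  rw [ENNReal.ofReal_pow (norm_nonneg _), ofReal_norm]

theorem ofReal_integral_le {Ω : Type*} [MeasurableSpace Ω] {μ : Measure Ω} {f : Ω → ℝ}
    (hf : Integrable f μ) : ENNReal.ofReal (∫ x, f x ∂μ) ≤ ∫⁻ x, ENNReal.ofReal (f x) ∂μ := by
  have h1 : ∫ x, f x ∂μ ≤ ∫ x, max (f x) 0 ∂μ :=
    integral_mono hf hf.pos_part fun x => le_max_left _ _
  refine (ENNReal.ofReal_le_ofReal h1).trans (le_of_eq ?_)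
  rw [ofReal_integral_eq_lintegral_ofReal hf.pos_part
    (Eventually.of_forall fun x => le_max_right _ _)]
  simp

/-- The value of the Kantorovich dual problem for the quadratic cost between two Gaussians at the
quadratic potentials given by `A` and `A⁻¹`. -/
noncomputable def dualCost (A : Matrix (Fin d) (Fin d) ℝ) (p q : BW d) : ℝ :=
  ‖p.mean - q.mean‖ ^ 2 + ((1 - A) * p.cov).trace + ((1 - A⁻¹) * q.cov).trace

theorem two_inner_le_of_posDef {A : Matrix (Fin d) (Fin d) ℝ} (hA : A.PosDef)
    (u w : EuclideanSpace ℝ (Fin d)) :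
    2 * inner ℝ u w ≤ inner ℝ u (matCLM A u) + inner ℝ w (matCLM A⁻¹ w) := by
  obtain ⟨R, hR, rfl⟩ := hA.exists_posDef_sq
  have hu : IsUnit R.det := hR.det_pos.ne'.isUnit
  have h1 : inner ℝ (matCLM R u) (matCLM R⁻¹ w) = (inner ℝ u w : ℝ) := by
    rw [inner_matCLM_left, hR.isSymm.eq, ← matCLM_mul_apply, Matrix.mul_nonsing_inv _ hu, matCLM,
      map_one, one_apply_eq_self]
  have h2 : inner ℝ u (matCLM (R * R) u) = ‖matCLM R u‖ ^ 2 := by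
    rw [matCLM_mul_apply, ← real_inner_self_eq_norm_sq, inner_matCLM_left, hR.isSymm.eq]
  have h3 : inner ℝ w (matCLM (R * R)⁻¹ w) = ‖matCLM R⁻¹ w‖ ^ 2 := by
    rw [Matrix.mul_inv_rev, matCLM_mul_apply, ← real_inner_self_eq_norm_sq, inner_matCLM_left,
      hR.inv.isSymm.eq]
  have h4 := norm_sub_sq_real (matCLM R u) (matCLM R⁻¹ w)
  rw [h1] at h4
  rw [h2, h3]
  linarith [sq_nonneg ‖matCLM R u - matCLM R⁻¹ w‖]

theorem inner_matCLM_one_sub (M : Matrix (Fin d) (Fin d) ℝ) (u : EuclideanSpace ℝ (Fin d)) :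
    inner ℝ u (matCLM (1 - M) u) = ‖u‖ ^ 2 - inner ℝ u (matCLM M u) := by
  rw [matCLM, map_sub, map_one, sub_apply, one_apply_eq_self, inner_sub_right,
    real_inner_self_eq_norm_sq]

/-- Weak Kantorovich duality. -/
theorem ofReal_dualCost_le {A : Matrix (Fin d) (Fin d) ℝ} (hA : A.PosDef) (p q : BW d) :
    ENNReal.ofReal (dualCost A p q) ≤ W₂ p.toMeasure q.toMeasure ^ 2 := by
  rw [W₂_sq]
  refine le_iInf₂ fun γ hγ => ?_
  set c := p.mean - q.mean
  have hp1 : Integrable (fun x => ‖c‖ ^ 2 + 2 * inner ℝ c (x - p.mean)) p.toMeasure :=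
    (integrable_const _).add ((p.integrable_inner_sub_mean c).const_mul 2)
  have hp2 := p.integrable_inner_matCLM (1 - A)
  have hq1 : Integrable (fun y => 2 * inner ℝ c (y - q.mean)) q.toMeasure :=
    (q.integrable_inner_sub_mean c).const_mul 2
  have hq2 := q.integrable_inner_matCLM (1 - A⁻¹)
  set f : EuclideanSpace ℝ (Fin d) → ℝ := fun x => ‖c‖ ^ 2 + 2 * inner ℝ c (x - p.mean) +
    inner ℝ (x - p.mean) (matCLM (1 - A) (x - p.mean)) with hf
  set g : EuclideanSpace ℝ (Fin d) → ℝ := fun y => inner ℝ (y - q.mean)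
    (matCLM (1 - A⁻¹) (y - q.mean)) - 2 * inner ℝ c (y - q.mean) with hg
  have hfi : Integrable f p.toMeasure := hp1.add hp2
  have hgi : Integrable g q.toMeasure := hq2.sub hq1
  have hfv : ∫ x, f x ∂p.toMeasure = ‖c‖ ^ 2 + ((1 - A) * p.cov).trace := by
    rw [hf, integral_add hp1 hp2, integral_add (integrable_const _)
      ((p.integrable_inner_sub_mean c).const_mul 2), integral_const_mul,
      p.integral_inner_sub_mean, p.integral_inner_matCLM]
    simp
  have hgv : ∫ y, g y ∂q.toMeasure = ((1 - A⁻¹) * q.cov).trace := by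
    rw [hg, integral_sub hq2 hq1, integral_const_mul, q.integral_inner_sub_mean,
      q.integral_inner_matCLM]
    simp
  have hfγ : Integrable (fun z : EuclideanSpace ℝ (Fin d) × EuclideanSpace ℝ (Fin d) => f z.1) γ :=
    (hγ.1 ▸ hfi).comp_measurable measurable_fst
  have hgγ : Integrable (fun z : EuclideanSpace ℝ (Fin d) × EuclideanSpace ℝ (Fin d) => g z.2) γ :=
    (hγ.2 ▸ hgi).comp_measurable measurable_snd
  have hval : ∫ z, (f z.1 + g z.2) ∂γ = dualCost A p q := by
    rw [integral_add hfγ hgγ, ← integral_map (φ := Prod.fst) (by fun_prop)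
      (by rw [hγ.1]; exact hfi.aestronglyMeasurable), ← integral_map (φ := Prod.snd) (by fun_prop)
      (by rw [hγ.2]; exact hgi.aestronglyMeasurable), hγ.1, hγ.2, hfv, hgv, dualCost]
  have hle : ∀ z : EuclideanSpace ℝ (Fin d) × EuclideanSpace ℝ (Fin d),
      f z.1 + g z.2 ≤ ‖z.1 - z.2‖ ^ 2 := fun z => by
    have h1 : z.1 - z.2 = c + ((z.1 - p.mean) - (z.2 - q.mean)) := by simp only [c]; abel
    have h2 := two_inner_le_of_posDef hA (z.1 - p.mean) (z.2 - q.mean)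
    rw [h1, norm_add_sq_real, norm_sub_sq_real (z.1 - p.mean), inner_sub_right]
    simp only [hf, hg, inner_matCLM_one_sub]
    linarith
  calc ENNReal.ofReal (dualCost A p q) = ENNReal.ofReal (∫ z, (f z.1 + g z.2) ∂γ) := by rw [hval]
    _ ≤ ∫⁻ z, ENNReal.ofReal (f z.1 + g z.2) ∂γ := ofReal_integral_le (hfγ.add hgγ)
    _ ≤ ∫⁻ z, ‖z.1 - z.2‖ₑ ^ 2 ∂γ := lintegral_mono fun z => by
        rw [enorm_sq_eq_ofReal]
        exact ENNReal.ofReal_le_ofReal (hle z)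

/-- The cost of a symmetric affine coupling bounds the Wasserstein distance. -/
theorem W₂_sq_le_of_affine (p q : BW d) {A : Matrix (Fin d) (Fin d) ℝ} (hA : A.IsSymm)
    (h : A * p.cov * A = q.cov) :
    W₂ p.toMeasure q.toMeasure ^ 2 ≤
      ENNReal.ofReal (bwInner p (q.mean - p.mean, A - 1) (q.mean - p.mean, A - 1)) := by
  have hm : Measurable fun x : EuclideanSpace ℝ (Fin d) =>
    (x, q.mean + matCLM A (x - p.mean)) := by fun_prop
  have hcoup : IsCoupling p.toMeasure q.toMeasure
      (p.toMeasure.map fun x => (x, q.mean + matCLM A (x - p.mean))) := by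
    constructor
    · rw [Measure.map_map measurable_fst hm]
      exact Measure.map_id
    · rw [Measure.map_map measurable_snd hm]
      exact p.map_affine q A (by rwa [hA.eq])
  rw [W₂_sq]
  refine (iInf₂_le _ hcoup).trans (le_of_eq ?_)
  rw [lintegral_map (by fun_prop) hm]
  have h1 : ∀ x : EuclideanSpace ℝ (Fin d), ‖x - (q.mean + matCLM A (x - p.mean))‖ₑ ^ 2 =
      ENNReal.ofReal (‖(q.mean - p.mean) + matCLM (A - 1) (x - p.mean)‖ ^ 2) := fun x => by
    rw [enorm_sq_eq_ofReal, ← norm_neg]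
    simp only [matCLM, map_sub, map_one, sub_apply, one_apply_eq_self]
    congr 3
    abel
  have h2 : (A - 1)ᵀ = A - 1 := by rw [Matrix.transpose_sub, hA.eq, Matrix.transpose_one]
  simp only [h1]
  rw [← ofReal_integral_eq_lintegral_ofReal (p.integrable_norm_affine_sq _ _)
    (Eventually.of_forall fun x => sq_nonneg _), p.integral_norm_affine_sq, bwInner,
    real_inner_self_eq_norm_sq]
  simp only [h2]
  rw [Matrix.trace_mul_comm (A - 1) (p.cov * _), mul_assoc, mul_assoc, Matrix.trace_mul_comm p.cov,
    mul_assoc]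

/-- There is no duality gap at the matrix of a transport map: the dual value equals the transport
cost. -/
theorem dualCost_eq_of_transport {p q : BW d} {A : Matrix (Fin d) (Fin d) ℝ} (hA : A.PosDef)
    (h : A * p.cov * A = q.cov) :
    dualCost A p q = bwInner p (q.mean - p.mean, A - 1) (q.mean - p.mean, A - 1) := by
  have hu : IsUnit A.det := hA.det_pos.ne'.isUnit
  have h1 : (A⁻¹ * q.cov).trace = (A * p.cov).trace := by
    rw [← h, Matrix.trace_mul_comm A, ← mul_assoc, ← mul_assoc, Matrix.nonsing_inv_mul _ hu,
      one_mul]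
  have h2 : ((A - 1)ᵀ * (p.cov * (A - 1))).trace =
      q.cov.trace - 2 * (A * p.cov).trace + p.cov.trace := by
    rw [Matrix.transpose_sub, hA.isSymm.eq, Matrix.transpose_one, sub_mul, mul_sub, mul_sub,
      ← mul_assoc, h]
    simp only [one_mul, mul_one, Matrix.trace_sub, Matrix.trace_mul_comm p.cov A]
    ring
  rw [dualCost, bwInner, h2, real_inner_self_eq_norm_sq, norm_sub_rev]
  simp only [sub_mul, one_mul, Matrix.trace_sub, h1]
  ring

theorem W₂_sq_eq_of_transport {p q : BW d} {A : Matrix (Fin d) (Fin d) ℝ} (hA : A.PosDef)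
    (h : A * p.cov * A = q.cov) :
    W₂ p.toMeasure q.toMeasure ^ 2 = ENNReal.ofReal (dualCost A p q) :=
  le_antisymm (by
    rw [dualCost_eq_of_transport hA h]
    exact W₂_sq_le_of_affine p q hA.isSymm h) (ofReal_dualCost_le hA p q)

theorem W₂_ne_top (p q : BW d) : W₂ p.toMeasure q.toMeasure ≠ ∞ := by
  obtain ⟨A, hA, h⟩ := exists_posDef_transport p.cov_posDef q.cov_posDef
  intro htop
  have := W₂_sq_eq_of_transport hA h
  simp [htop] at this

theorem bwInner_self_nonneg (p : BW d) (v : TangentPair d) : 0 ≤ bwInner p v v := by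
  have h : (v.2ᴴ * p.cov * v.2).PosSemidef :=
    p.cov_posDef.posSemidef.conjTranspose_mul_mul_same v.2
  rw [bwInner, ← mul_assoc]
  exact add_nonneg real_inner_self_nonneg (by simpa using h.trace_nonneg)

theorem toReal_W₂_sq_eq_of_transport {p q : BW d} {A : Matrix (Fin d) (Fin d) ℝ} (hA : A.PosDef)
    (h : A * p.cov * A = q.cov) :
    (W₂ p.toMeasure q.toMeasure).toReal ^ 2 = dualCost A p q := by
  rw [← ENNReal.toReal_pow, W₂_sq_eq_of_transport hA h, ENNReal.toReal_ofReal]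
  rw [dualCost_eq_of_transport hA h]
  exact bwInner_self_nonneg p _

theorem dualCost_le {A : Matrix (Fin d) (Fin d) ℝ} (hA : A.PosDef) (p q : BW d) :
    dualCost A p q ≤ (W₂ p.toMeasure q.toMeasure).toReal ^ 2 := by
  rw [← ENNReal.toReal_pow]
  exact (ENNReal.ofReal_le_iff_le_toReal (ENNReal.pow_ne_top (W₂_ne_top p q))).1
    (ofReal_dualCost_le hA p q)

end Wasserstein

/-! ### The divergence of a Gaussian from a Gibbs measure -/

section KL

open Filter

variable {d : ℕ} {V : EuclideanSpace ℝ (Fin d) → ℝ}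

theorem BW.toMeasure_absolutelyContinuous (p : BW d) : p.toMeasure ≪ volume := by
  rw [p.toMeasure_eq_tilted]
  exact tilted_absolutelyContinuous _ _

theorem BW.llr_volume (p : BW d) : llr p.toMeasure volume =ᵐ[p.toMeasure]
    fun x => p.logDensity x - Real.log (∫ y, Real.exp (p.logDensity y)) := by
  refine p.toMeasure_absolutelyContinuous.ae_eq ?_
  have := log_rnDeriv_tilted_left_self p.integrable_exp_logDensity
  rwa [← p.toMeasure_eq_tilted] at this

theorem BW.integrable_logDensity (p : BW d) : Integrable p.logDensity p.toMeasure :=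
  (p.integrable_inner_matCLM _).const_mul _

theorem BW.integral_logDensity (p : BW d) : ∫ x, p.logDensity x ∂p.toMeasure = -(d / 2) := by
  simp only [BW.logDensity]
  rw [integral_const_mul, p.integral_inner_matCLM,
    Matrix.nonsing_inv_mul _ p.cov_posDef.det_pos.ne'.isUnit]
  simp
  ring

theorem BW.integrable_llr_volume (p : BW d) : Integrable (llr p.toMeasure volume) p.toMeasure :=
  (integrable_congr p.llr_volume).2 (p.integrable_logDensity.sub (integrable_const _))

/-- Finiteness of the divergence forces integrability of the potential, since the entropy of a
Gaussian is finite. -/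
theorem integrable_potential (hπ : Integrable (fun x => Real.exp (-V x)) volume) {p : BW d}
    (hp : klDiv p.toMeasure (targetMeasure V) ≠ ∞) : Integrable V p.toMeasure := by
  have h1 := (klDiv_ne_top_iff.1 hp).2
  rw [targetMeasure, integrable_congr (llr_tilted_right p.toMeasure_absolutelyContinuous hπ)] at h1
  refine ((h1.sub p.integrable_llr_volume).sub
    (integrable_const (Real.log (∫ z, Real.exp (-V z))))).congr (Eventually.of_forall fun x => ?_)
  simp

/-- The additive constant in the formula for the divergence. -/
noncomputable def klConst (V : EuclideanSpace ℝ (Fin d) → ℝ) : ℝ :=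
  Real.log (∫ x, Real.exp (-V x)) - d / 2 - Real.log ((2 * Real.pi) ^ ((d : ℝ) / 2))

/-- The divergence is the sum of the potential energy, of the negative entropy and of a constant. -/
theorem klTo_eq (hπ : Integrable (fun x => Real.exp (-V x)) volume) {p : BW d}
    (hp : klDiv p.toMeasure (targetMeasure V) ≠ ∞) :
    klTo V p = ∫ x, V x ∂p.toMeasure - 1 / 2 * Real.log p.cov.det + klConst V := by
  have hV := integrable_potential hπ hp
  have hac := (klDiv_ne_top_iff.1 hp).1
  have : IsProbabilityMeasure (targetMeasure V) := isProbabilityMeasure_tilted hπ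
  rw [klTo, toReal_klDiv_of_measure_eq hac (by simp), targetMeasure,
    integral_llr_tilted_right (f := fun x => -V x) p.toMeasure_absolutelyContinuous hV.neg hπ
      p.integrable_llr_volume,
    integral_congr_ae p.llr_volume, integral_sub p.integrable_logDensity (integrable_const _),
    p.integral_logDensity, p.integral_exp_logDensity, Real.log_mul
      (Real.sqrt_ne_zero'.2 p.cov_posDef.det_pos) (by positivity), Real.log_sqrt
      p.cov_posDef.det_pos.le, integral_neg, klConst]
  simp
  ring

theorem klTo_nonneg (p : BW d) : 0 ≤ klTo V p := ENNReal.toReal_nonneg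

end KL

/-! ### The divergence as a smooth function of mean and covariance -/

section Smooth

open Filter Topology

variable {d : ℕ} {V : EuclideanSpace ℝ (Fin d) → ℝ}

attribute [local instance] Matrix.normedAddCommGroup Matrix.normedSpace

/-- The sufficient statistic of the exponential family of the Gaussians: the linear form
`(h, P) ↦ h · x - x · P x / 2` in the natural parameters. -/
noncomputable def suffStat (x : EuclideanSpace ℝ (Fin d)) : TangentPair d →L[ℝ] ℝ :=
  LinearMap.toContinuousLinearMap
    { toFun := fun θ => inner ℝ θ.1 x - 1 / 2 * inner ℝ x (matCLM θ.2 x)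
      map_add' := fun θ θ' => by
        simp only [Prod.fst_add, Prod.snd_add, matCLM, map_add, add_apply, inner_add_left,
          inner_add_right]
        ring
      map_smul' := fun c θ => by
        simp only [Prod.smul_fst, Prod.smul_snd, matCLM, map_smul, smul_apply,
          real_inner_smul_left, real_inner_smul_right, RingHom.id_apply, smul_eq_mul]
        ring }

theorem suffStat_apply (x : EuclideanSpace ℝ (Fin d)) (θ : TangentPair d) :
    suffStat x θ = inner ℝ θ.1 x - 1 / 2 * inner ℝ x (matCLM θ.2 x) := rfl

theorem continuous_suffStat_apply (θ : TangentPair d) : Continuous fun x => suffStat x θ := by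
  change Continuous fun x => inner ℝ θ.1 x - 1 / 2 * inner ℝ x (matCLM θ.2 x)
  fun_prop

/-- The pairs `(m, M)` of a vector and a matrix with positive quadratic form: an open subset of a
vector space in which the mean and covariance of non-degenerate Gaussians lie. -/
def paramDomain (d : ℕ) : Set (TangentPair d) := {z | z.2 ∈ posForm d}

theorem isOpen_paramDomain : IsOpen (paramDomain d) :=
  isOpen_posForm.preimage continuous_snd

/-- The mean and the covariance of a Gaussian. -/
def BW.toPair (p : BW d) : TangentPair d := (p.mean, p.cov)

theorem BW.toPair_mem (p : BW d) : p.toPair ∈ paramDomain d := p.cov_posDef.mem_posForm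

/-- The natural parameters `(Σ⁻¹ m, Σ⁻¹)`. -/
noncomputable def natParam (z : TangentPair d) : TangentPair d := (matCLM z.2⁻¹ z.1, z.2⁻¹)

theorem natParam_mem {z : TangentPair d} (hz : z ∈ paramDomain d) :
    natParam z ∈ paramDomain d := inv_mem_posForm hz

theorem suffStat_natParam (p : BW d) (x : EuclideanSpace ℝ (Fin d)) :
    suffStat x (natParam p.toPair) =
      p.logDensity x + 1 / 2 * inner ℝ p.mean (matCLM p.cov⁻¹ p.mean) := by
  have h : inner ℝ p.mean (matCLM p.cov⁻¹ x) = (inner ℝ x (matCLM p.cov⁻¹ p.mean) : ℝ) := by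
    rw [← real_inner_comm, inner_matCLM_left, p.cov_posDef.inv.isSymm.eq]
  have h2 : inner ℝ (matCLM p.cov⁻¹ p.mean) x = (inner ℝ x (matCLM p.cov⁻¹ p.mean) : ℝ) :=
    real_inner_comm _ _
  rw [suffStat_apply, BW.logDensity]
  simp only [natParam, BW.toPair, map_sub, inner_sub_left, inner_sub_right, h, h2]
  ring

/-- Every element of the parameter domain defines the same exponential weight as the natural
parameters of a Gaussian. -/
theorem exists_suffStat_eq {θ : TangentPair d} (hθ : θ ∈ paramDomain d) :
    ∃ p : BW d, ∀ x, suffStat x θ = suffStat x (natParam p.toPair) := by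
  have hform : ∀ x : Fin d → ℝ,
      x ⬝ᵥ ((1 / 2 : ℝ) • (θ.2 + θ.2ᵀ)) *ᵥ x = x ⬝ᵥ θ.2 *ᵥ x := fun x => by
    have h : x ⬝ᵥ θ.2ᵀ *ᵥ x = x ⬝ᵥ θ.2 *ᵥ x := by
      rw [Matrix.mulVec_transpose, dotProduct_comm, Matrix.dotProduct_mulVec]
    rw [Matrix.smul_mulVec, Matrix.add_mulVec, dotProduct_smul, dotProduct_add, h]
    simp only [smul_eq_mul]
    ring
  have hP : ((1 / 2 : ℝ) • (θ.2 + θ.2ᵀ)).PosDef := by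
    refine posDef_of_mem_posForm ?_ fun x hx => by rw [hform]; exact hθ x hx
    rw [Matrix.IsSymm, Matrix.transpose_smul, Matrix.transpose_add, Matrix.transpose_transpose,
      add_comm]
  set P := (1 / 2 : ℝ) • (θ.2 + θ.2ᵀ)
  refine ⟨⟨matCLM P⁻¹ θ.1, P⁻¹, hP.inv⟩, fun x => ?_⟩
  have h1 : natParam (BW.toPair ⟨matCLM P⁻¹ θ.1, P⁻¹, hP.inv⟩) = (θ.1, P) := by
    have hu : IsUnit P.det := hP.det_pos.ne'.isUnit
    simp only [natParam, BW.toPair]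
    rw [Matrix.nonsing_inv_nonsing_inv _ hu, ← matCLM_mul_apply, Matrix.mul_nonsing_inv _ hu,
      matCLM, map_one, one_apply_eq_self]
  rw [h1, suffStat_apply, suffStat_apply, matCLM, matCLM, Matrix.inner_toEuclideanCLM,
    Matrix.inner_toEuclideanCLM, hform]

theorem integrable_exp_suffStat_smul {F : Type*} [NormedAddCommGroup F] [NormedSpace ℝ F]
    {W : EuclideanSpace ℝ (Fin d) → F} (hW : ∀ p : BW d, Integrable W p.toMeasure)
    {θ : TangentPair d} (hθ : θ ∈ paramDomain d) :
    Integrable fun x => Real.exp (suffStat x θ) • W x := by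
  obtain ⟨p, hp⟩ := exists_suffStat_eq hθ
  have h := hW p
  rw [p.toMeasure_eq_tilted, integrable_tilted_iff p.integrable_exp_logDensity] at h
  refine (h.smul (Real.exp (1 / 2 * inner ℝ p.mean (matCLM p.cov⁻¹ p.mean)))).congr
    (Eventually.of_forall fun x => ?_)
  simp only [Pi.smul_apply]
  rw [hp, suffStat_natParam, Real.exp_add, smul_smul, mul_comm]

theorem integral_exp_suffStat_smul {F : Type*} [NormedAddCommGroup F] [NormedSpace ℝ F]
    (W : EuclideanSpace ℝ (Fin d) → F) (p : BW d) :
    ∫ x, Real.exp (suffStat x (natParam p.toPair)) • W x =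
      (∫ x, Real.exp (suffStat x (natParam p.toPair))) • ∫ x, W x ∂p.toMeasure := by
  have hZ : ∫ x, Real.exp (p.logDensity x) ≠ 0 :=
    (integral_exp_pos p.integrable_exp_logDensity).ne'
  rw [p.toMeasure_eq_tilted, integral_tilted]
  simp only [suffStat_natParam, Real.exp_add, div_eq_inv_mul, mul_smul]
  rw [integral_smul, integral_mul_const, mul_comm (∫ x, Real.exp (p.logDensity x)), mul_smul,
    smul_smul _ _ (∫ x, _), mul_inv_cancel₀ hZ, one_smul, ← integral_smul]
  refine integral_congr_ae (Eventually.of_forall fun x => ?_)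
  exact smul_comm _ _ _

/-- The extension of the potential energy `(m, Σ) ↦ ∫ V d𝒩(m, Σ)` to the parameter domain. -/
noncomputable def extEnergy (V : EuclideanSpace ℝ (Fin d) → ℝ) (z : TangentPair d) : ℝ :=
  (∫ x, Real.exp (suffStat x (natParam z)) • V x) / ∫ x, Real.exp (suffStat x (natParam z))

/-- The extension of the divergence `(m, Σ) ↦ KL(𝒩(m, Σ) ‖ π)` to the parameter domain. -/
noncomputable def extKL (V : EuclideanSpace ℝ (Fin d) → ℝ) (z : TangentPair d) : ℝ :=
  extEnergy V z - 1 / 2 * Real.log z.2.det + klConst V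

theorem integral_exp_suffStat_pos {θ : TangentPair d} (hθ : θ ∈ paramDomain d) :
    0 < ∫ x, Real.exp (suffStat x θ) := by
  have := integrable_exp_suffStat_smul (W := fun _ : EuclideanSpace ℝ (Fin d) => (1 : ℝ))
    (fun p => integrable_const _) hθ
  exact integral_exp_pos (by simpa using this)

theorem extEnergy_toPair (p : BW d) : extEnergy V p.toPair = ∫ x, V x ∂p.toMeasure := by
  rw [extEnergy, integral_exp_suffStat_smul, smul_eq_mul,
    mul_div_cancel_left₀ _ (integral_exp_suffStat_pos (natParam_mem p.toPair_mem)).ne']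

theorem extKL_toPair (hπ : Integrable (fun x => Real.exp (-V x)) volume) {p : BW d}
    (hp : klDiv p.toMeasure (targetMeasure V) ≠ ∞) : extKL V p.toPair = klTo V p := by
  rw [klTo_eq hπ hp, extKL, extEnergy_toPair]
  rfl

theorem contDiffOn_natParam {n : WithTop ℕ∞} :
    ContDiffOn ℝ n (natParam (d := d)) (paramDomain d) := by
  have hinv : ContDiffOn ℝ n (fun z : TangentPair d => z.2⁻¹) (paramDomain d) :=
    contDiffOn_matrix_inv.comp contDiff_snd.contDiffOn fun z hz => hz
  have hlin : ContDiff ℝ n fun M : Matrix (Fin d) (Fin d) ℝ => matCLM M :=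
    (LinearMap.toContinuousLinearMap
      (Matrix.toEuclideanCLM (𝕜 := ℝ) (n := Fin d)).toAlgEquiv.toLinearMap).contDiff
  exact ((hlin.comp_contDiffOn hinv).clm_apply contDiff_fst.contDiffOn).prodMk hinv

theorem contDiffOn_extEnergy (hVc : Continuous V)
    (hV : ∀ p : BW d, Integrable V p.toMeasure) (n : ℕ) :
    ContDiffOn ℝ n (extEnergy V) (paramDomain d) := by
  have h1 : ContDiffOn ℝ n (fun θ => ∫ x, Real.exp (suffStat x θ) • V x) (paramDomain d) :=
    contDiffOn_integral_exp_smul n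
      (aestronglyMeasurable_of_continuous_apply continuous_suffStat_apply)
      hVc.aestronglyMeasurable isOpen_paramDomain fun θ hθ => integrable_exp_suffStat_smul hV hθ
  have h2 : ContDiffOn ℝ n (fun θ => ∫ x, Real.exp (suffStat x θ) • (1 : ℝ)) (paramDomain d) :=
    contDiffOn_integral_exp_smul n
      (aestronglyMeasurable_of_continuous_apply continuous_suffStat_apply)
      aestronglyMeasurable_const isOpen_paramDomain fun θ hθ =>
        integrable_exp_suffStat_smul (W := fun _ => (1 : ℝ)) (fun p => integrable_const _) hθ
  simp only [smul_eq_mul, mul_one] at h2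
  exact (h1.comp contDiffOn_natParam fun z hz => natParam_mem hz).div
    (h2.comp contDiffOn_natParam fun z hz => natParam_mem hz)
    fun z hz => (integral_exp_suffStat_pos (natParam_mem hz)).ne'

theorem contDiffOn_extKL (hVc : Continuous V)
    (hV : ∀ p : BW d, Integrable V p.toMeasure) (n : ℕ) :
    ContDiffOn ℝ n (extKL V) (paramDomain d) := by
  have hdet : ContDiff ℝ n fun z : TangentPair d => z.2.det :=
    contDiff_det fun i j => (contDiff_matrix_apply i j).comp contDiff_snd
  exact ((contDiffOn_extEnergy hVc hV n).sub (contDiffOn_const.mul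
    (hdet.contDiffOn.log fun z hz => det_ne_zero_of_mem_posForm hz))).add contDiffOn_const

end Smooth

/-! ### Semiconvexity of the potential -/

section Semiconvex

open Filter Topology

variable {d : ℕ} {V : EuclideanSpace ℝ (Fin d) → ℝ} {α : ℝ}

/-- A chord inequality with quadratic correction differentiates at the left endpoint to a tangent
inequality with quadratic correction. -/
theorem deriv_le_of_chord_le {f : ℝ → ℝ} {f' b c : ℝ} (hf : HasDerivAt f f' 0)
    (h : ∀ s ∈ Icc (0 : ℝ) 1, f s ≤ (1 - s) * f 0 + s * b - c * s * (1 - s)) :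
    f' ≤ b - f 0 - c := by
  have hslope := (hasDerivWithinAt_iff_tendsto_slope' (by simp)).1
    (hf.hasDerivWithinAt (s := Ioi 0))
  have hlim : Tendsto (fun s : ℝ => b - f 0 - c * (1 - s)) (𝓝[>] 0) (𝓝 (b - f 0 - c)) := by
    have : Continuous fun s : ℝ => b - f 0 - c * (1 - s) := by fun_prop
    simpa using (this.tendsto 0).mono_left nhdsWithin_le_nhds
  refine le_of_tendsto_of_tendsto hslope hlim ?_
  filter_upwards [Ioo_mem_nhdsGT (zero_lt_one' ℝ)] with s hs
  rw [slope_def_field, sub_zero, div_le_iff₀ hs.1]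
  have := h s (Ioo_subset_Icc_self hs)
  nlinarith

/-- The chord inequality of a potential with Hessian bounded below: on each line, subtracting
`α / 2 ‖w‖² t²` leaves a convex function. -/
theorem semiconvex_of_hessian_ge (hV : ContDiff ℝ 2 V)
    (hα : ∀ x v : EuclideanSpace ℝ (Fin d), α * ‖v‖ ^ 2 ≤ fderiv ℝ (fderiv ℝ V) x v v)
    (x w : EuclideanSpace ℝ (Fin d)) {s : ℝ} (hs : s ∈ Icc (0 : ℝ) 1) :
    V (x + s • w) ≤ (1 - s) * V x + s * V (x + w) - α / 2 * ‖w‖ ^ 2 * s * (1 - s) := by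
  have hV1 : Differentiable ℝ V := hV.differentiable two_ne_zero
  have hV2 : Differentiable ℝ (fderiv ℝ V) :=
    (hV.fderiv_right (m := 1) (by norm_num)).differentiable one_ne_zero
  have hline : ∀ t : ℝ, HasDerivAt (fun t : ℝ => x + t • w) w t := fun t => by
    simpa using ((hasDerivAt_id t).smul_const w).const_add x
  have h1 : ∀ t : ℝ, HasDerivAt (fun t : ℝ => V (x + t • w) - α / 2 * ‖w‖ ^ 2 * t ^ 2)
      (fderiv ℝ V (x + t • w) w - α * ‖w‖ ^ 2 * t) t := fun t => by
    refine ((hV1 (x + t • w)).hasFDerivAt.comp_hasDerivAt t (hline t)).sub ?_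
    refine ((hasDerivAt_pow 2 t).const_mul (α / 2 * ‖w‖ ^ 2)).congr_deriv ?_
    simp
    ring
  have h2 : ∀ t : ℝ, HasDerivAt (fun t : ℝ => fderiv ℝ V (x + t • w) w - α * ‖w‖ ^ 2 * t)
      (fderiv ℝ (fderiv ℝ V) (x + t • w) w w - α * ‖w‖ ^ 2) t := fun t => by
    have h := ((ContinuousLinearMap.apply ℝ ℝ w).hasFDerivAt.comp_hasDerivAt t
      ((hV2 (x + t • w)).hasFDerivAt.comp_hasDerivAt t (hline t)))
    have h' : HasDerivAt (fun t : ℝ => α * ‖w‖ ^ 2 * t) (α * ‖w‖ ^ 2) t := by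
      simpa only [id, mul_one] using (hasDerivAt_id t).const_mul (α * ‖w‖ ^ 2)
    exact h.sub h'
  have hd1 : deriv (fun t : ℝ => V (x + t • w) - α / 2 * ‖w‖ ^ 2 * t ^ 2) =
      fun t => fderiv ℝ V (x + t • w) w - α * ‖w‖ ^ 2 * t := funext fun t => (h1 t).deriv
  have hconv : ConvexOn ℝ univ fun t : ℝ => V (x + t • w) - α / 2 * ‖w‖ ^ 2 * t ^ 2 := by
    refine convexOn_univ_of_deriv2_nonneg (fun t => (h1 t).differentiableAt) ?_ fun t => ?_
    · rw [hd1]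
      exact fun t => (h2 t).differentiableAt
    · rw [Function.iterate_succ, Function.iterate_one, Function.comp_apply, hd1, (h2 t).deriv]
      linarith [hα (x + t • w) w]
  have := hconv.2 (mem_univ 0) (mem_univ 1) (sub_nonneg.2 hs.2) hs.1 (by ring)
  simp only [smul_eq_mul, mul_zero, mul_one, zero_add, zero_smul, add_zero, one_smul] at this
  nlinarith

/-- A potential with Hessian bounded below is bounded below by a quadratic function. -/
theorem quadratic_le_of_hessian_ge (hV : ContDiff ℝ 2 V)
    (hα : ∀ x v : EuclideanSpace ℝ (Fin d), α * ‖v‖ ^ 2 ≤ fderiv ℝ (fderiv ℝ V) x v v)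
    (y : EuclideanSpace ℝ (Fin d)) : V 0 + fderiv ℝ V 0 y + α / 2 * ‖y‖ ^ 2 ≤ V y := by
  have hline : HasDerivAt (fun t : ℝ => t • y) y 0 := by
    simpa using (hasDerivAt_id (0 : ℝ)).smul_const y
  have hd : HasDerivAt (fun t : ℝ => V (t • y)) (fderiv ℝ V 0 y) 0 := by
    have h1 : HasFDerivAt V (fderiv ℝ V 0) ((0 : ℝ) • y) := by
      rw [zero_smul]
      exact (hV.differentiable two_ne_zero 0).hasFDerivAt
    exact h1.comp_hasDerivAt 0 hline
  have := deriv_le_of_chord_le (b := V y) (c := α / 2 * ‖y‖ ^ 2) hd fun s hs => by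
    simpa using semiconvex_of_hessian_ge hV hα 0 y hs
  simp only [zero_smul] at this
  linarith

end Semiconvex

/-! ### Convexity of the divergence along Wasserstein geodesics -/

section Geodesic

open Filter Topology

variable {d : ℕ} {V : EuclideanSpace ℝ (Fin d) → ℝ} {α : ℝ}

theorem posDef_conj {p : BW d} {B : Matrix (Fin d) (Fin d) ℝ} (hB : B.PosDef) :
    (B * p.cov * B).PosDef := by
  simpa [hB.isSymm.eq] using p.cov_posDef.conjTranspose_mul_mul_same (B := B)
    (Matrix.mulVec_injective_iff_isUnit.2 hB.isUnit)

/-- The point at time `s` of the Wasserstein geodesic that starts at `p` in the direction of the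
affine map with linear part `A` and maps the mean of `p` to `b`. -/
noncomputable def BW.geodesic (p : BW d) (b : EuclideanSpace ℝ (Fin d))
    {A : Matrix (Fin d) (Fin d) ℝ} (hA : A.PosDef) {s : ℝ} (hs : s ∈ Icc (0 : ℝ) 1) : BW d where
  mean := p.mean + s • (b - p.mean)
  cov := (1 + s • (A - 1)) * p.cov * (1 + s • (A - 1))
  cov_posDef := posDef_conj (posDef_one_add_smul_sub_one hA hs)

theorem BW.integral_geodesic (p : BW d) (b : EuclideanSpace ℝ (Fin d))
    {A : Matrix (Fin d) (Fin d) ℝ} (hA : A.PosDef) {s : ℝ} (hs : s ∈ Icc (0 : ℝ) 1)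
    {W : EuclideanSpace ℝ (Fin d) → ℝ} (hW : Continuous W)
    (hWi : Integrable W (p.geodesic b hA hs).toMeasure) :
    Integrable (fun x => W (x + s • ((b - p.mean) + matCLM (A - 1) (x - p.mean)))) p.toMeasure ∧
    ∫ x, W x ∂(p.geodesic b hA hs).toMeasure =
      ∫ x, W (x + s • ((b - p.mean) + matCLM (A - 1) (x - p.mean))) ∂p.toMeasure := by
  have hB := posDef_one_add_smul_sub_one hA hs
  have hmap := p.map_affine (p.geodesic b hA hs) (1 + s • (A - 1)) (by rw [hB.isSymm.eq]; rfl)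
  have heq : (fun x => (p.geodesic b hA hs).mean + matCLM (1 + s • (A - 1)) (x - p.mean)) =
      fun x => x + s • ((b - p.mean) + matCLM (A - 1) (x - p.mean)) := by
    funext x
    simp only [BW.geodesic, matCLM, map_add, map_smul, map_one, add_apply, smul_apply,
      one_apply_eq_self, smul_add]
    abel
  rw [heq] at hmap
  have hm : Measurable fun x : EuclideanSpace ℝ (Fin d) =>
    x + s • ((b - p.mean) + matCLM (A - 1) (x - p.mean)) := by fun_prop
  constructor
  · rw [← hmap] at hWi
    exact hWi.comp_measurable hm
  · rw [← hmap, integral_map hm.aemeasurable hW.aestronglyMeasurable]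

/-- Along the geodesic from `p` to `q` the divergence satisfies the chord inequality of an
`α`-convex function. -/
theorem klTo_geodesic_le (hV : ContDiff ℝ 2 V)
    (hπ : Integrable (fun x => Real.exp (-V x)) volume)
    (hKL : ∀ p : BW d, klDiv p.toMeasure (targetMeasure V) ≠ ∞)
    (hα : ∀ x v : EuclideanSpace ℝ (Fin d), α * ‖v‖ ^ 2 ≤ fderiv ℝ (fderiv ℝ V) x v v)
    {p q : BW d} {A : Matrix (Fin d) (Fin d) ℝ} (hA : A.PosDef) (h : A * p.cov * A = q.cov)
    {s : ℝ} (hs : s ∈ Icc (0 : ℝ) 1) :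
    klTo V (p.geodesic q.mean hA hs) ≤ (1 - s) * klTo V p + s * klTo V q -
      α / 2 * (W₂ p.toMeasure q.toMeasure).toReal ^ 2 * s * (1 - s) := by
  have hVi : ∀ p : BW d, Integrable V p.toMeasure := fun p => integrable_potential hπ (hKL p)
  have hVc : Continuous V := hV.continuous
  set w : EuclideanSpace ℝ (Fin d) → EuclideanSpace ℝ (Fin d) := fun x =>
    (q.mean - p.mean) + matCLM (A - 1) (x - p.mean) with hw
  have h1mem : (1 : ℝ) ∈ Icc (0 : ℝ) 1 := ⟨zero_le_one, le_rfl⟩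
  have hq : p.geodesic q.mean hA h1mem = q := by
    refine BW.ext ?_ ?_
    · simp [BW.geodesic]
    · simp [BW.geodesic, h]
  obtain ⟨hsi, hsv⟩ := p.integral_geodesic q.mean hA hs hVc (hVi _)
  obtain ⟨h1i, h1v⟩ := p.integral_geodesic q.mean hA h1mem hVc (hVi _)
  rw [hq] at h1v
  simp only [one_smul] at h1i h1v
  have hwi : Integrable (fun x => ‖w x‖ ^ 2) p.toMeasure := p.integrable_norm_affine_sq _ _
  have hsymm : (A - 1)ᵀ = A - 1 := by
    rw [Matrix.transpose_sub, hA.isSymm.eq, Matrix.transpose_one]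
  have hwv : ∫ x, ‖w x‖ ^ 2 ∂p.toMeasure = (W₂ p.toMeasure q.toMeasure).toReal ^ 2 := by
    rw [toReal_W₂_sq_eq_of_transport hA h, dualCost_eq_of_transport hA h,
      p.integral_norm_affine_sq, bwInner, real_inner_self_eq_norm_sq]
    simp only [hsymm]
    rw [Matrix.trace_mul_comm (A - 1) (p.cov * _), mul_assoc, mul_assoc,
      Matrix.trace_mul_comm p.cov, mul_assoc]
  have henergy : ∫ x, V x ∂(p.geodesic q.mean hA hs).toMeasure ≤
      (1 - s) * ∫ x, V x ∂p.toMeasure + s * ∫ x, V x ∂q.toMeasure -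
        α / 2 * (W₂ p.toMeasure q.toMeasure).toReal ^ 2 * s * (1 - s) := by
    have hint1 := (hVi p).const_mul (1 - s)
    have hint2 := h1i.const_mul s
    have hint3 := hwi.const_mul (α / 2 * s * (1 - s))
    calc ∫ x, V x ∂(p.geodesic q.mean hA hs).toMeasure = ∫ x, V (x + s • w x) ∂p.toMeasure := hsv
      _ ≤ ∫ x, ((1 - s) * V x + s * V (x + w x) - α / 2 * s * (1 - s) * ‖w x‖ ^ 2) ∂p.toMeasure :=
        integral_mono hsi ((hint1.add hint2).sub hint3) fun x => by
          have := semiconvex_of_hessian_ge hV hα x (w x) hs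
          dsimp only
          linarith
      _ = _ := by
        rw [integral_sub (by exact hint1.add hint2) hint3, integral_add hint1 hint2,
          integral_const_mul, integral_const_mul, integral_const_mul, hwv, h1v]
        ring
  have hB := posDef_one_add_smul_sub_one hA hs
  have hdet1 : Real.log (p.geodesic q.mean hA hs).cov.det =
      2 * Real.log (1 + s • (A - 1)).det + Real.log p.cov.det := by
    rw [BW.geodesic, Matrix.det_mul, Matrix.det_mul, Real.log_mul
      (mul_ne_zero hB.det_pos.ne' p.cov_posDef.det_pos.ne') hB.det_pos.ne', Real.log_mul
      hB.det_pos.ne' p.cov_posDef.det_pos.ne']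
    ring
  have hdet2 : Real.log q.cov.det = 2 * Real.log A.det + Real.log p.cov.det := by
    rw [← h, Matrix.det_mul, Matrix.det_mul, Real.log_mul
      (mul_ne_zero hA.det_pos.ne' p.cov_posDef.det_pos.ne') hA.det_pos.ne', Real.log_mul
      hA.det_pos.ne' p.cov_posDef.det_pos.ne']
    ring
  rw [klTo_eq hπ (hKL _), klTo_eq hπ (hKL p), klTo_eq hπ (hKL q), hdet1, hdet2]
  have := mul_log_det_le hA hs
  nlinarith

end Geodesic

/-! ### The Riemannian gradient of the divergence -/

section Gradient

open Filter Topology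

variable {d : ℕ} {V : EuclideanSpace ℝ (Fin d) → ℝ} {α : ℝ}

attribute [local instance] Matrix.normedAddCommGroup Matrix.normedSpace

theorem contDiffOn_fderiv_apply {E : Type*} [NormedAddCommGroup E] [NormedSpace ℝ E] {f : E → ℝ}
    {U : Set E} (hU : IsOpen U) (hf : ContDiffOn ℝ 2 f U) (w : E) :
    ContDiffOn ℝ 1 (fun z => fderiv ℝ f z w) U :=
  (hf.fderiv_of_isOpen hU (by norm_num)).clm_apply contDiffOn_const

/-- The chain rule along a curve, with the derivative read as a linear form. -/
theorem hasDerivWithinAt_comp_of_contDiffOn {E : Type*} [NormedAddCommGroup E] [NormedSpace ℝ E]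
    {f : E → ℝ} {U : Set E} (hU : IsOpen U) (hf : ContDiffOn ℝ 2 f U) {c : ℝ → E} {c' : E}
    {s : Set ℝ} {t : ℝ} (ht : c t ∈ U) (hc : HasDerivWithinAt c c' s t) :
    HasDerivWithinAt (fun τ => f (c τ)) (fderiv ℝ f (c t) c') s t :=
  (((hf.differentiableOn two_ne_zero).differentiableAt
    (hU.mem_nhds ht)).hasFDerivAt).comp_hasDerivWithinAt t hc

/-- The differential of the extended divergence, as a linear form. -/
noncomputable def diffKL (V : EuclideanSpace ℝ (Fin d) → ℝ) (z : TangentPair d) :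
    TangentPair d →ₗ[ℝ] ℝ where
  toFun w := fderiv ℝ (extKL V) z w
  map_add' := map_add _
  map_smul' := map_smul _

/-- The pair `(a, S)` that represents a linear form `L` on `ℝᵈ × ℝᵈˣᵈ` with respect to the
Bures-Wasserstein metric: `a` is the Euclidean gradient in the mean, and `S = G + Gᵀ` for the
Euclidean gradient `G` in the covariance. -/
noncomputable def gradOf (L : TangentPair d →ₗ[ℝ] ℝ) : TangentPair d :=
  (WithLp.toLp 2 fun i => L (EuclideanSpace.single i 1, 0),
    Matrix.of fun i j => L (0, Matrix.single i j 1) + L (0, Matrix.single j i 1))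

theorem gradOf_isSymm (L : TangentPair d →ₗ[ℝ] ℝ) : (gradOf L).2.IsSymm :=
  Matrix.IsSymm.ext fun i j => by simp [gradOf, add_comm]

theorem apply_eq_bwInner_gradOf (L : TangentPair d →ₗ[ℝ] ℝ) (p : BW d) {v : TangentPair d}
    (hv : v.2.IsSymm) : L (v.1, v.2 * p.cov + p.cov * v.2) = bwInner p (gradOf L) v := by
  obtain ⟨b, S⟩ := v
  change S.IsSymm at hv
  set G : Matrix (Fin d) (Fin d) ℝ := Matrix.of fun i j => L (0, Matrix.single i j 1) with hG
  have hvec : ∀ b : EuclideanSpace ℝ (Fin d), L (b, 0) = inner ℝ (gradOf L).1 b := fun b => by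
    have hb : ((b, 0) : TangentPair d) =
        ∑ i, b i • ((EuclideanSpace.single i (1 : ℝ), 0) : TangentPair d) := by
      refine Prod.ext ?_ ?_
      · simpa [Prod.fst_sum] using ((EuclideanSpace.basisFun (Fin d) ℝ).sum_repr b).symm
      · simp [Prod.snd_sum]
    rw [hb, map_sum, PiLp.inner_apply]
    simp only [map_smul]
    simp [gradOf]
  have hmat : ∀ N : Matrix (Fin d) (Fin d) ℝ, L (0, N) = (Gᵀ * N).trace := fun N => by
    have hN : ((0, N) : TangentPair d) =
        ∑ i, ∑ j, N i j • ((0, Matrix.single i j 1) : TangentPair d) := by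
      refine Prod.ext ?_ ?_
      · simp [Prod.fst_sum]
      · simpa [Prod.snd_sum, Matrix.smul_single] using Matrix.matrix_eq_sum_single N
    rw [hN, map_sum]
    simp only [map_sum, map_smul, smul_eq_mul, Matrix.trace, Matrix.diag, Matrix.mul_apply,
      Matrix.transpose_apply, hG, Matrix.of_apply]
    rw [Finset.sum_comm]
    exact Finset.sum_congr rfl fun i _ => Finset.sum_congr rfl fun j _ => mul_comm _ _
  have hS : (gradOf L).2 = G + Gᵀ := by
    ext i j
    simp [gradOf, hG]
  have hsplit : ((b, S * p.cov + p.cov * S) : TangentPair d) =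
      (b, 0) + (0, S * p.cov + p.cov * S) := by simp
  rw [hsplit, map_add, hvec, hmat, bwInner, hS]
  have h1 : (G * (p.cov * S)).trace = (Gᵀ * (S * p.cov)).trace := by
    rw [← Matrix.trace_transpose, Matrix.transpose_mul, Matrix.transpose_mul, hv.eq,
      p.cov_posDef.isSymm.eq, Matrix.trace_mul_comm]
  simp only [Matrix.transpose_add, Matrix.transpose_transpose, Matrix.add_mul, Matrix.mul_add,
    Matrix.trace_add, h1]
  ring

/-- The Bures-Wasserstein gradient of the divergence at the Gaussian with mean and covariance
`z`. -/
noncomputable def klGrad (V : EuclideanSpace ℝ (Fin d) → ℝ) (z : TangentPair d) : TangentPair d :=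
  gradOf (diffKL V z)

/-- The curve through `p` with constant velocity in the coordinates `(m, Σ)` and tangent vector `v`
at time `0`. It is set to `p` at the times at which the coordinates leave the domain. -/
noncomputable def BW.line (p : BW d) (v : TangentPair d) (t : ℝ) : BW d :=
  open scoped Classical in
  if h : (p.cov + t • (v.2 * p.cov + p.cov * v.2)).PosDef then ⟨p.mean + t • v.1, _, h⟩ else p

theorem BW.isSymm_lyapunov (p : BW d) {S : Matrix (Fin d) (Fin d) ℝ} (hS : S.IsSymm) :
    (S * p.cov + p.cov * S).IsSymm := by
  rw [Matrix.IsSymm, Matrix.transpose_add, Matrix.transpose_mul, Matrix.transpose_mul, hS.eq,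
    p.cov_posDef.isSymm.eq, add_comm]

theorem BW.line_eventually (p : BW d) {v : TangentPair d} (hv : v.2.IsSymm) :
    ∀ᶠ t in 𝓝 (0 : ℝ), (p.line v t).mean = p.mean + t • v.1 ∧
      (p.line v t).cov = p.cov + t • (v.2 * p.cov + p.cov * v.2) := by
  have hc : Continuous fun t : ℝ => p.cov + t • (v.2 * p.cov + p.cov * v.2) := by fun_prop
  filter_upwards [hc.continuousAt.eventually (isOpen_posForm.mem_nhds
    (by simpa using p.cov_posDef.mem_posForm))] with t ht
  have hpos := posDef_of_mem_posForm
    (p.cov_posDef.isSymm.add ((p.isSymm_lyapunov hv).smul t)) ht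
  rw [BW.line, dif_pos hpos]
  exact ⟨rfl, rfl⟩

theorem BW.line_zero (p : BW d) (v : TangentPair d) : p.line v 0 = p := by
  rw [BW.line]
  split_ifs
  · ext <;> simp
  · rfl

theorem BW.hasBWTangentWithinAt_line (p : BW d) {v : TangentPair d} (hv : v.2.IsSymm) :
    HasBWTangentWithinAt (p.line v) v univ 0 := by
  refine ⟨hv, ?_, fun i j => ?_⟩
  · rw [hasDerivWithinAt_univ]
    refine HasDerivAt.congr_of_eventuallyEq (f := fun t => p.mean + t • v.1) ?_
      ((p.line_eventually hv).mono fun t h => h.1)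
    simpa using ((hasDerivAt_id (0 : ℝ)).smul_const v.1).const_add p.mean
  · rw [hasDerivWithinAt_univ, p.line_zero]
    refine HasDerivAt.congr_of_eventuallyEq
      (f := fun t => p.cov i j + t * (v.2 * p.cov + p.cov * v.2) i j) ?_
      ((p.line_eventually hv).mono fun t h => ?_)
    · simpa using ((hasDerivAt_id (0 : ℝ)).mul_const _).const_add (p.cov i j)
    · dsimp only
      rw [h.2]
      rfl

theorem eq_zero_of_bwInner_self_eq_zero (p : BW d) {v : TangentPair d} (h : bwInner p v v = 0) :
    v = 0 := by
  obtain ⟨b, S⟩ := v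
  obtain ⟨R, hR, hRR⟩ := p.cov_posDef.exists_posDef_sq
  have h2 : (Sᵀ * (p.cov * S)).trace = ((R * S)ᵀ * (R * S)).trace := by
    rw [← hRR, Matrix.transpose_mul, hR.isSymm.eq]
    simp only [mul_assoc]
  have h3 : 0 ≤ ((R * S)ᵀ * (R * S)).trace := by
    have := (Matrix.posSemidef_conjTranspose_mul_self (R * S)).trace_nonneg
    rwa [Matrix.conjTranspose_eq_transpose_of_trivial] at this
  simp only [bwInner, real_inner_self_eq_norm_sq] at h
  rw [h2] at h
  have hb : b = 0 := by
    have : ‖b‖ ^ 2 = 0 := by nlinarith [sq_nonneg ‖b‖]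
    simpa using this
  have htr : ((R * S)ᵀ * (R * S)).trace = 0 := by nlinarith [sq_nonneg ‖b‖]
  have hRS : R * S = 0 := by
    rw [← Matrix.conjTranspose_eq_transpose_of_trivial] at htr
    exact Matrix.trace_conjTranspose_mul_self_eq_zero_iff.1 htr
  have hS : S = 0 := by
    have := congrArg (R⁻¹ * ·) hRS
    simpa [Matrix.nonsing_inv_mul_cancel_left _ _ hR.det_pos.ne'.isUnit] using this
  rw [hb, hS]
  rfl

theorem bwInner_sub_left (p : BW d) (u v w : TangentPair d) :
    bwInner p (u - v) w = bwInner p u w - bwInner p v w := by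
  simp only [bwInner, Prod.fst_sub, Prod.snd_sub, inner_sub_left, Matrix.transpose_sub,
    Matrix.sub_mul, Matrix.trace_sub]
  ring

theorem bwInner_neg_right (p : BW d) (v w : TangentPair d) :
    bwInner p v (-w) = -bwInner p v w := by
  simp only [bwInner, Prod.fst_neg, Prod.snd_neg, inner_neg_right, Matrix.mul_neg,
    Matrix.trace_neg]
  ring

theorem bwInner_comm (p : BW d) (v w : TangentPair d) : bwInner p v w = bwInner p w v := by
  rw [bwInner, bwInner, real_inner_comm, ← Matrix.trace_transpose, Matrix.transpose_mul,
    Matrix.transpose_mul, Matrix.transpose_transpose, p.cov_posDef.isSymm.eq, mul_assoc]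

theorem bwInner_quadratic_nonneg (p : BW d) (v w : TangentPair d) (c : ℝ) :
    0 ≤ bwInner p v v + 2 * c * bwInner p v w + c ^ 2 * bwInner p w w := by
  have h : bwInner p (v + c • w) (v + c • w) =
      bwInner p v v + c * bwInner p v w + c * bwInner p w v + c ^ 2 * bwInner p w w := by
    simp only [bwInner, Prod.fst_add, Prod.snd_add, Prod.smul_fst, Prod.smul_snd, inner_add_left,
      inner_add_right, real_inner_smul_left, real_inner_smul_right, Matrix.transpose_add,
      Matrix.transpose_smul, Matrix.add_mul, Matrix.mul_add, Matrix.smul_mul, Matrix.mul_smul,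
      Matrix.trace_add, Matrix.trace_smul, smul_eq_mul]
    ring
  have := bwInner_self_nonneg p (v + c • w)
  rw [h, bwInner_comm p w v] at this
  linarith

theorem HasBWTangentWithinAt.hasDerivWithinAt_toPair {q : ℝ → BW d} {v : TangentPair d}
    {s : Set ℝ} {t : ℝ} (h : HasBWTangentWithinAt q v s t) :
    HasDerivWithinAt (fun τ => (q τ).toPair) (v.1, v.2 * (q t).cov + (q t).cov * v.2) s t :=
  h.2.1.prodMk (hasDerivWithinAt_matrix_iff.2 h.2.2)

/-- The chain rule for the divergence along a curve of Gaussians. -/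
theorem HasBWTangentWithinAt.hasDerivWithinAt_klTo (hV : Continuous V)
    (hπ : Integrable (fun x => Real.exp (-V x)) volume)
    (hKL : ∀ p : BW d, klDiv p.toMeasure (targetMeasure V) ≠ ∞)
    {q : ℝ → BW d} {v : TangentPair d} {s : Set ℝ} {t : ℝ} (h : HasBWTangentWithinAt q v s t) :
    HasDerivWithinAt (fun τ => klTo V (q τ)) (bwInner (q t) (klGrad V (q t).toPair) v) s t := by
  have hC : ContDiffOn ℝ 2 (extKL V) (paramDomain d) :=
    contDiffOn_extKL hV (fun p => integrable_potential hπ (hKL p)) 2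
  have := hasDerivWithinAt_comp_of_contDiffOn isOpen_paramDomain hC (q t).toPair_mem
    h.hasDerivWithinAt_toPair
  simp only [extKL_toPair hπ (hKL _)] at this
  refine this.congr_deriv ?_
  exact apply_eq_bwInner_gradOf (diffKL V (q t).toPair) (q t) h.1

theorem hasBWGradientAt_klGrad (hV : Continuous V)
    (hπ : Integrable (fun x => Real.exp (-V x)) volume)
    (hKL : ∀ p : BW d, klDiv p.toMeasure (targetMeasure V) ≠ ∞) (p : BW d) :
    HasBWGradientAt (klTo V) (klGrad V p.toPair) p := by
  refine ⟨gradOf_isSymm _, fun q v hq h => ?_⟩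
  have := h.hasDerivWithinAt_klTo hV hπ hKL
  rwa [hasDerivWithinAt_univ, hq] at this

/-- The gradient is unique: two gradients differ by a tangent vector orthogonal to itself. -/
theorem HasBWGradientAt.eq {F : BW d → ℝ} {g g' : TangentPair d} {p : BW d}
    (h : HasBWGradientAt F g p) (h' : HasBWGradientAt F g' p) : g = g' := by
  have hs : (g - g').2.IsSymm := h.1.sub h'.1
  have := (h.2 _ _ (p.line_zero _) (p.hasBWTangentWithinAt_line hs)).unique
    (h'.2 _ _ (p.line_zero _) (p.hasBWTangentWithinAt_line hs))
  refine sub_eq_zero.1 (eq_zero_of_bwInner_self_eq_zero p ?_)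
  rw [bwInner_sub_left, this, sub_self]

/-- The tangent inequality of the `α`-convex divergence: it lies above its linearization along
the optimal transport map, up to `α / 2` times the squared Wasserstein distance. -/
theorem bwInner_klGrad_le (hV : ContDiff ℝ 2 V)
    (hπ : Integrable (fun x => Real.exp (-V x)) volume)
    (hKL : ∀ p : BW d, klDiv p.toMeasure (targetMeasure V) ≠ ∞)
    (hα : ∀ x v : EuclideanSpace ℝ (Fin d), α * ‖v‖ ^ 2 ≤ fderiv ℝ (fderiv ℝ V) x v v)
    {p q : BW d} {A : Matrix (Fin d) (Fin d) ℝ} (hA : A.PosDef) (h : A * p.cov * A = q.cov) :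
    bwInner p (klGrad V p.toPair) (q.mean - p.mean, A - 1) ≤
      klTo V q - klTo V p - α / 2 * (W₂ p.toMeasure q.toMeasure).toReal ^ 2 := by
  have hC : ContDiffOn ℝ 2 (extKL V) (paramDomain d) :=
    contDiffOn_extKL hV.continuous (fun p => integrable_potential hπ (hKL p)) 2
  have hS : (A - 1).IsSymm := hA.isSymm.sub Matrix.isSymm_one
  set c : ℝ → TangentPair d := fun s => (p.mean + s • (q.mean - p.mean),
    p.cov + s • ((A - 1) * p.cov + p.cov * (A - 1)) + s ^ 2 • ((A - 1) * p.cov * (A - 1))) with hc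
  have hgeo : ∀ {s : ℝ} (hs : s ∈ Icc (0 : ℝ) 1), c s = (p.geodesic q.mean hA hs).toPair := by
    intro s hs
    refine Prod.ext rfl ?_
    simp only [hc, BW.toPair, BW.geodesic]
    simp only [Matrix.add_mul, Matrix.mul_add, one_mul, mul_one, Matrix.smul_mul, Matrix.mul_smul,
      smul_add, smul_smul, pow_two]
    abel
  have hc0 : c 0 = p.toPair := by simp [hc, BW.toPair]
  have hd1 : HasDerivAt (fun s : ℝ => p.mean + s • (q.mean - p.mean)) (q.mean - p.mean) 0 := by
    simpa using ((hasDerivAt_id (0 : ℝ)).smul_const (q.mean - p.mean)).const_add p.mean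
  have hd2 : HasDerivAt (fun s : ℝ => p.cov + s • ((A - 1) * p.cov + p.cov * (A - 1)) +
      s ^ 2 • ((A - 1) * p.cov * (A - 1))) ((A - 1) * p.cov + p.cov * (A - 1)) 0 := by
    have h1 := ((hasDerivAt_id (0 : ℝ)).smul_const
      ((A - 1) * p.cov + p.cov * (A - 1))).const_add p.cov
    have h2 := (hasDerivAt_pow 2 (0 : ℝ)).smul_const ((A - 1) * p.cov * (A - 1))
    refine (h1.add h2).congr_deriv ?_
    simp
  have hd : HasDerivAt (fun s => extKL V (c s))
      (bwInner p (klGrad V p.toPair) (q.mean - p.mean, A - 1)) 0 := by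
    have hcd : HasDerivWithinAt c (q.mean - p.mean, (A - 1) * p.cov + p.cov * (A - 1)) univ 0 :=
      (hd1.prodMk hd2).hasDerivWithinAt
    have := hasDerivWithinAt_comp_of_contDiffOn isOpen_paramDomain hC
      (by rw [hc0]; exact p.toPair_mem) hcd
    rw [hc0, hasDerivWithinAt_univ] at this
    refine this.congr_deriv ?_
    exact apply_eq_bwInner_gradOf (diffKL V p.toPair) p (v := (q.mean - p.mean, A - 1)) hS
  have := deriv_le_of_chord_le (b := klTo V q)
    (c := α / 2 * (W₂ p.toMeasure q.toMeasure).toReal ^ 2) hd fun s hs => by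
      rw [hgeo hs, hc0, extKL_toPair hπ (hKL _), extKL_toPair hπ (hKL _)]
      exact klTo_geodesic_le hV hπ hKL hα hA h hs
  rwa [hc0, extKL_toPair hπ (hKL _)] at this

end Gradient

/-! ### Existence and uniqueness of the gradient flow -/

section Flow

open Filter Topology

variable {d : ℕ} {V : EuclideanSpace ℝ (Fin d) → ℝ} {α : ℝ}

attribute [local instance] Matrix.normedAddCommGroup Matrix.normedSpace

theorem le_of_hasDerivWithinAt_nonpos {f f' : ℝ → ℝ} {T : ℝ} (hT : 0 ≤ T)
    (hf : ∀ t ∈ Icc 0 T, HasDerivWithinAt f (f' t) (Icc 0 T) t) (hf' : ∀ t ∈ Icc 0 T, f' t ≤ 0) :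
    f T ≤ f 0 :=
  le_of_touching_from_below hT (fun t ht => (hf t ht).continuousWithinAt) fun t ht =>
    ⟨f, f' t, hf' t (Ioc_subset_Icc_self ht), rfl, fun _ _ => le_rfl,
      (hf t (Ioc_subset_Icc_self ht)).mono (Icc_subset_Icc_right ht.2)⟩

/-- The vector field `-∇KL` in the coordinates `(m, Σ)`. The transpose makes its matrix component
symmetric at every `z`, so that its integral curves do not leave the symmetric matrices. -/
noncomputable def klField (V : EuclideanSpace ℝ (Fin d) → ℝ) (z : TangentPair d) : TangentPair d :=
  (-(klGrad V z).1, -((klGrad V z).2 * z.2 + z.2ᵀ * (klGrad V z).2))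

theorem contDiffOn_klField (hV : Continuous V) (hVi : ∀ p : BW d, Integrable V p.toMeasure) :
    ContDiffOn ℝ 1 (klField V) (paramDomain d) := by
  have hC : ContDiffOn ℝ 2 (extKL V) (paramDomain d) := contDiffOn_extKL hV hVi 2
  have hL : ∀ w, ContDiffOn ℝ 1 (fun z => diffKL V z w) (paramDomain d) :=
    contDiffOn_fderiv_apply isOpen_paramDomain hC
  have hS : ∀ i j, ContDiffOn ℝ 1 (fun z => (klGrad V z).2 i j) (paramDomain d) := fun i j =>
    (hL _).add (hL _)
  have hz : ∀ i j, ContDiffOn ℝ 1 (fun z : TangentPair d => z.2 i j) (paramDomain d) := fun i j =>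
    ((contDiff_matrix_apply i j).comp contDiff_snd).contDiffOn
  refine ContDiffOn.prodMk (ContDiffOn.neg ?_) (contDiffOn_matrix_iff.2 fun i j => ?_)
  · exact contDiffOn_euclidean.2 fun i => hL _
  · simp only [Matrix.neg_apply, Matrix.add_apply, Matrix.mul_apply, Matrix.transpose_apply]
    exact (ContDiffOn.add (ContDiffOn.sum fun k _ => (hS i k).mul (hz k j))
      (ContDiffOn.sum fun k _ => (hz k i).mul (hS k j))).neg

theorem klField_toPair (p : BW d) : klField V p.toPair =
    ((-klGrad V p.toPair).1,
      (-klGrad V p.toPair).2 * p.cov + p.cov * (-klGrad V p.toPair).2) := by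
  refine Prod.ext rfl ?_
  have hs : p.toPair.2ᵀ = p.cov := p.cov_posDef.isSymm.eq
  simp only [klField, hs, Prod.snd_neg, Matrix.neg_mul, Matrix.mul_neg, neg_add]
  rfl

/-- An integral curve of `-∇KL` that starts at a Gaussian consists of Gaussians, since its matrix
component stays symmetric. -/
theorem exists_bw_of_solution {I : Set ℝ} (hI : ∀ t ∈ I, 0 ≤ t ∧ Icc 0 t ⊆ I) {p₀ : BW d}
    {y : ℝ → TangentPair d} (h0 : y 0 = p₀.toPair)
    (hy : ∀ t ∈ I, y t ∈ paramDomain d ∧ HasDerivWithinAt y (klField V (y t)) I t) :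
    ∃ p : ℝ → BW d, p 0 = p₀ ∧ ∀ t ∈ I, (p t).toPair = y t ∧
      HasBWTangentWithinAt p (-klGrad V (p t).toPair) I t := by
  classical
  have hd2 : ∀ t ∈ I, ∀ i j,
      HasDerivWithinAt (fun τ => (y τ).2 i j) ((klField V (y t)).2 i j) I t := fun t ht =>
    hasDerivWithinAt_matrix_iff.1 ((hy t ht).2.snd)
  have hfs : ∀ z i j, (klField V z).2 i j = (klField V z).2 j i := fun z i j => by
    have hS : (klGrad V z).2ᵀ = (klGrad V z).2 := gradOf_isSymm _
    have : (klField V z).2ᵀ = (klField V z).2 := by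
      simp only [klField, Matrix.transpose_neg, Matrix.transpose_add, Matrix.transpose_mul,
        Matrix.transpose_transpose, hS]
      rw [add_comm]
    exact congrFun₂ this j i
  have hle : ∀ t ∈ I, ∀ i j, (y t).2 i j - (y t).2 j i ≤ (y 0).2 i j - (y 0).2 j i :=
    fun t ht i j => le_of_hasDerivWithinAt_nonpos (hI t ht).1
      (f := fun t => (y t).2 i j - (y t).2 j i) (f' := fun _ => 0) (fun s hs => by
        have hsI := (hI t ht).2 hs
        have := ((hd2 s hsI i j).sub (hd2 s hsI j i)).mono (hI t ht).2
        rwa [hfs _ i j, sub_self] at this) fun _ _ => le_rfl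
  have hsymm : ∀ t ∈ I, (y t).2.IsSymm := fun t ht => Matrix.IsSymm.ext fun i j => by
    have h1 := hle t ht i j
    have h2 := hle t ht j i
    have h3 : (y 0).2 i j = (y 0).2 j i := by
      rw [h0]
      exact p₀.cov_posDef.isSymm.apply j i
    linarith
  set p : ℝ → BW d := fun t => if h : (y t).2.PosDef then ⟨(y t).1, (y t).2, h⟩ else p₀ with hp
  have hpy : ∀ t ∈ I, (p t).toPair = y t := fun t ht => by
    have : (y t).2.PosDef := posDef_of_mem_posForm (hsymm t ht) (hy t ht).1
    simp only [hp, dif_pos this]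
    rfl
  have hm : ∀ t ∈ I, (p t).mean = (y t).1 := fun t ht => congrArg Prod.fst (hpy t ht)
  have hc : ∀ t ∈ I, (p t).cov = (y t).2 := fun t ht => congrArg Prod.snd (hpy t ht)
  refine ⟨p, ?_, fun t ht => ⟨hpy t ht, ?_, ?_, fun i j => ?_⟩⟩
  · have : (y 0).2.PosDef := by
      rw [h0]
      exact p₀.cov_posDef
    simp only [hp, dif_pos this]
    exact BW.ext (congrArg Prod.fst h0) (congrArg Prod.snd h0)
  · exact (gradOf_isSymm _).neg
  · have : HasDerivWithinAt (fun τ => (y τ).1) (klField V (y t)).1 I t := (hy t ht).2.fst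
    rw [← hpy t ht, klField_toPair] at this
    exact this.congr hm (hm t ht)
  · have := hd2 t ht i j
    rw [← hpy t ht, klField_toPair] at this
    exact this.congr (fun s hs => by rw [hc s hs]) (by rw [hc t ht])

/-- The second moment `∫ ‖x‖² dp`. -/
noncomputable def BW.secondMoment (p : BW d) : ℝ := ‖p.mean‖ ^ 2 + p.cov.trace

theorem BW.secondMoment_nonneg (p : BW d) : 0 ≤ p.secondMoment :=
  add_nonneg (sq_nonneg _) p.cov_posDef.posSemidef.trace_nonneg

theorem HasBWTangentWithinAt.hasDerivWithinAt_secondMoment {p : ℝ → BW d} {v : TangentPair d}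
    {s : Set ℝ} {t : ℝ} (h : HasBWTangentWithinAt p v s t) :
    HasDerivWithinAt (fun τ => (p τ).secondMoment) (2 * bwInner (p t) v ((p t).mean, 1)) s t := by
  have h1 := h.2.1.norm_sq
  have h2 : HasDerivWithinAt (fun τ => (p τ).cov.trace)
      (v.2 * (p t).cov + (p t).cov * v.2).trace s t := by
    simp only [Matrix.trace, Matrix.diag]
    exact HasDerivWithinAt.fun_sum fun i _ => h.2.2 i i
  refine (h1.add h2).congr_deriv ?_
  rw [bwInner, h.1.eq, Matrix.trace_add, Matrix.trace_mul_comm (p t).cov, mul_one,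
    real_inner_comm]
  ring

/-- Young's inequality for the Bures-Wasserstein metric and the field `x ↦ x`, whose squared norm
is the second moment. -/
theorem neg_two_mul_bwInner_le (p : BW d) (v : TangentPair d) :
    -(2 * bwInner p v (p.mean, 1)) ≤ bwInner p v v + p.secondMoment := by
  have h : bwInner p (p.mean, 1) (p.mean, 1) = p.secondMoment := by
    simp [bwInner, BW.secondMoment]
  have := bwInner_quadratic_nonneg p v (p.mean, 1) 1
  rw [h] at this
  linarith

/-- A quadratic lower bound on the potential turns a bound on the divergence into a lower bound on
the determinant of the covariance. -/
theorem exists_det_lower_bound (hV : ContDiff ℝ 2 V)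
    (hπ : Integrable (fun x => Real.exp (-V x)) volume)
    (hKL : ∀ p : BW d, klDiv p.toMeasure (targetMeasure V) ≠ ∞)
    (hα : ∀ x v : EuclideanSpace ℝ (Fin d), α * ‖v‖ ^ 2 ≤ fderiv ℝ (fderiv ℝ V) x v v) (B C : ℝ) :
    ∃ c > 0, ∀ p : BW d, p.secondMoment ≤ B → klTo V p ≤ C → c ≤ p.cov.det := by
  refine ⟨Real.exp (2 * (V 0 - ‖fderiv ℝ V 0‖ * (1 + B) - |α| / 2 * B + klConst V - C)),
    Real.exp_pos _, fun p hB hC => ?_⟩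
  rw [← Real.le_log_iff_exp_le p.cov_posDef.det_pos]
  have hi : Integrable (fun x => ‖x‖ ^ 2) p.toMeasure := by
    simpa [matCLM] using p.integrable_norm_affine_sq p.mean 1
  have hv : ∫ x, ‖x‖ ^ 2 ∂p.toMeasure = p.secondMoment := by
    simpa [matCLM, BW.secondMoment] using p.integral_norm_affine_sq p.mean 1
  have hi1 : Integrable (fun x => ‖x‖) p.toMeasure := by
    simpa using (p.integrable_sub_mean.add (integrable_const p.mean)).norm
  have hs := p.secondMoment_nonneg
  have hbound : ∀ x, V 0 - ‖fderiv ℝ V 0‖ * (1 + ‖x‖ ^ 2) - |α| / 2 * ‖x‖ ^ 2 ≤ V x := fun x => by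
    have h1 := quadratic_le_of_hessian_ge hV hα x
    have h2 := (abs_le.1 ((fderiv ℝ V 0).le_opNorm x)).1
    have h3 : ‖fderiv ℝ V 0‖ * ‖x‖ ≤ ‖fderiv ℝ V 0‖ * (1 + ‖x‖ ^ 2) :=
      mul_le_mul_of_nonneg_left (by nlinarith [sq_nonneg (‖x‖ - 1)]) (norm_nonneg _)
    have h4 : -|α| * ‖x‖ ^ 2 ≤ α * ‖x‖ ^ 2 :=
      mul_le_mul_of_nonneg_right (neg_abs_le α) (sq_nonneg _)
    linarith
  have hint : V 0 - ‖fderiv ℝ V 0‖ * (1 + p.secondMoment) - |α| / 2 * p.secondMoment ≤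
      ∫ x, V x ∂p.toMeasure := by
    have hi2 : Integrable (fun x => ‖fderiv ℝ V 0‖ * (1 + ‖x‖ ^ 2)) p.toMeasure :=
      ((integrable_const 1).add hi).const_mul _
    have hi3 := hi.const_mul (|α| / 2)
    have := integral_mono (((integrable_const (V 0)).sub hi2).sub hi3)
      (integrable_potential hπ (hKL p)) hbound
    simp only [Pi.sub_apply] at this
    rw [integral_sub (by exact (integrable_const (V 0)).sub hi2) hi3,
      integral_sub (integrable_const _) hi2, integral_const_mul, integral_const_mul,
      integral_add (integrable_const _) hi, hv] at this
    simpa using this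
  have hkl := klTo_eq hπ (hKL p)
  have h1 : ‖fderiv ℝ V 0‖ * p.secondMoment ≤ ‖fderiv ℝ V 0‖ * B :=
    mul_le_mul_of_nonneg_left hB (norm_nonneg _)
  have h2 : |α| * p.secondMoment ≤ |α| * B := mul_le_mul_of_nonneg_left hB (abs_nonneg _)
  linarith

/-- The coordinates of the Gaussians whose second moment is at most `B` and whose covariance has
determinant at least `c` lie in a compact subset of the parameter domain. -/
theorem exists_isCompact_toPair_mem (B : ℝ) {c : ℝ} (hc : 0 < c) :
    ∃ K : Set (TangentPair d), IsCompact K ∧ K ⊆ paramDomain d ∧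
      ∀ p : BW d, p.secondMoment ≤ B → c ≤ p.cov.det → p.toPair ∈ K := by
  have hK : IsCompact (Metric.closedBall (0 : EuclideanSpace ℝ (Fin d)) (1 + B) ×ˢ
      {M : Matrix (Fin d) (Fin d) ℝ | ∀ i ∈ univ, M i ∈
        {r : Fin d → ℝ | ∀ j ∈ univ, r j ∈ Icc (-B) B}}) :=
    (isCompact_closedBall _ _).prod
      (isCompact_univ_pi fun _ => isCompact_univ_pi fun _ => isCompact_Icc)
  have hclosed : IsClosed {z : TangentPair d | z.2ᵀ = z.2 ∧
      (∀ x : Fin d → ℝ, 0 ≤ x ⬝ᵥ z.2 *ᵥ x) ∧ c ≤ z.2.det} := by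
    refine (isClosed_eq (by fun_prop) (by fun_prop)).inter (IsClosed.inter ?_ ?_)
    · have : {z : TangentPair d | ∀ x : Fin d → ℝ, 0 ≤ x ⬝ᵥ z.2 *ᵥ x} =
          ⋂ x : Fin d → ℝ, {z | 0 ≤ x ⬝ᵥ z.2 *ᵥ x} := by
        ext z
        simp
      change IsClosed {z : TangentPair d | ∀ x : Fin d → ℝ, 0 ≤ x ⬝ᵥ z.2 *ᵥ x}
      rw [this]
      refine isClosed_iInter fun x => isClosed_le continuous_const ?_
      exact continuous_const.dotProduct (continuous_snd.matrix_mulVec continuous_const)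
    · exact isClosed_le continuous_const continuous_snd.matrix_det
  refine ⟨_, hK.inter_right hclosed, fun z hz => ?_, fun p hB hdet => ⟨⟨?_, ?_⟩, ?_, ?_, hdet⟩⟩
  · obtain ⟨-, hs, hpos, hd⟩ := hz
    have hps : z.2.PosSemidef := Matrix.PosSemidef.of_dotProduct_mulVec_nonneg
      (by simpa [Matrix.IsHermitian] using hs) (by simpa using hpos)
    exact (hps.posDef_iff_det_ne_zero.2 (hc.trans_le hd).ne').mem_posForm
  · have htr := p.cov_posDef.posSemidef.trace_nonneg
    rw [BW.secondMoment] at hB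
    rw [mem_closedBall_zero_iff]
    change ‖p.mean‖ ≤ _
    nlinarith [sq_nonneg (‖p.mean‖ - 1)]
  · intro i _ j _
    have h := abs_le.1 (abs_apply_le_trace p.cov_posDef.posSemidef i j)
    have hm := sq_nonneg ‖p.mean‖
    rw [BW.secondMoment] at hB
    change p.cov i j ∈ Icc (-B) B
    exact ⟨by linarith [h.1], by linarith [h.2]⟩
  · exact p.cov_posDef.isSymm.eq
  · exact fun x => by simpa [BW.toPair] using p.cov_posDef.posSemidef.dotProduct_mulVec_nonneg x

/-- The divergence dissipates at the rate of the squared norm of its gradient. -/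
theorem hasDerivWithinAt_klTo_flow (hV : Continuous V)
    (hπ : Integrable (fun x => Real.exp (-V x)) volume)
    (hKL : ∀ p : BW d, klDiv p.toMeasure (targetMeasure V) ≠ ∞) {p : ℝ → BW d} {s : Set ℝ} {t : ℝ}
    (h : HasBWTangentWithinAt p (-klGrad V (p t).toPair) s t) :
    HasDerivWithinAt (fun τ => klTo V (p τ))
      (-bwInner (p t) (klGrad V (p t).toPair) (klGrad V (p t).toPair)) s t := by
  rw [← bwInner_neg_right]
  exact h.hasDerivWithinAt_klTo hV hπ hKL

/-- Along the flow the divergence does not increase, and the sum of second moment and divergence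
grows at most exponentially. -/
theorem flow_bounds (hV : Continuous V)
    (hπ : Integrable (fun x => Real.exp (-V x)) volume)
    (hKL : ∀ p : BW d, klDiv p.toMeasure (targetMeasure V) ≠ ∞) {p : ℝ → BW d} {T : ℝ} (hT : 0 ≤ T)
    (h : ∀ t ∈ Icc 0 T, HasBWTangentWithinAt p (-klGrad V (p t).toPair) (Icc 0 T) t) :
    klTo V (p T) ≤ klTo V (p 0) ∧
      (p T).secondMoment ≤ Real.exp T * ((p 0).secondMoment + klTo V (p 0)) := by
  have hF := fun t ht => hasDerivWithinAt_klTo_flow hV hπ hKL (h t ht)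
  refine ⟨le_of_hasDerivWithinAt_nonpos hT hF fun t ht =>
    neg_nonpos.2 (bwInner_self_nonneg _ _), ?_⟩
  have hexp : ∀ t : ℝ, HasDerivAt (fun t => Real.exp (-t)) (-Real.exp (-t)) t := fun t => by
    simpa using (hasDerivAt_neg t).exp
  have hmain := le_of_hasDerivWithinAt_nonpos hT
    (f := fun t => Real.exp (-t) * ((p t).secondMoment + klTo V (p t)))
    (fun t ht => (hexp t).hasDerivWithinAt.mul
      ((h t ht).hasDerivWithinAt_secondMoment.add (hF t ht))) fun t ht => by
    have h1 := neg_two_mul_bwInner_le (p t) (klGrad V (p t).toPair)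
    have h2 : bwInner (p t) (-klGrad V (p t).toPair) ((p t).mean, 1) =
        -bwInner (p t) (klGrad V (p t).toPair) ((p t).mean, 1) := by
      rw [← zero_sub, bwInner_sub_left]
      simp [bwInner]
    have h3 := klTo_nonneg (V := V) (p t)
    have h4 := Real.exp_pos (-t)
    rw [h2]
    nlinarith
  simp only [neg_zero, Real.exp_zero, one_mul] at hmain
  have h3 := klTo_nonneg (V := V) (p T)
  have h4 := mul_le_mul_of_nonneg_left hmain (Real.exp_pos T).le
  rw [← mul_assoc, ← Real.exp_add, add_neg_cancel, Real.exp_zero, one_mul] at h4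
  linarith

theorem exists_gradientFlow (hV : ContDiff ℝ 2 V)
    (hπ : Integrable (fun x => Real.exp (-V x)) volume)
    (hKL : ∀ p : BW d, klDiv p.toMeasure (targetMeasure V) ≠ ∞)
    (hα : ∀ x v : EuclideanSpace ℝ (Fin d), α * ‖v‖ ^ 2 ≤ fderiv ℝ (fderiv ℝ V) x v v)
    (p₀ : BW d) : ∃ p : ℝ → BW d, IsBWGradientFlow (klTo V) p ∧ p 0 = p₀ := by
  have hVi : ∀ p : BW d, Integrable V p.toMeasure := fun p => integrable_potential hπ (hKL p)
  have hS : 0 ≤ p₀.secondMoment + klTo V p₀ := add_nonneg p₀.secondMoment_nonneg (klTo_nonneg _)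
  obtain ⟨y, hy0, hy⟩ := exists_forward_solution isOpen_paramDomain
    (contDiffOn_klField hV.continuous hVi) (x₀ := p₀.toPair) (fun T hT => by
      set B := Real.exp T * (p₀.secondMoment + klTo V p₀) with hB
      obtain ⟨c, hc, hdet⟩ := exists_det_lower_bound hV hπ hKL hα B (klTo V p₀)
      obtain ⟨K, hK, hKU, hmem⟩ := exists_isCompact_toPair_mem (d := d) B hc
      refine ⟨K, hK, hKU, fun T' hT' y hy0 hy => ?_⟩
      obtain ⟨p, hp0, hp⟩ := exists_bw_of_solution (I := Icc 0 T')
        (fun t ht => ⟨ht.1, Icc_subset_Icc_right ht.2⟩) hy0 hy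
      obtain ⟨h1, h2⟩ := flow_bounds hV.continuous hπ hKL hT'.1 fun t ht => (hp t ht).2
      rw [hp0] at h1 h2
      have h3 : (p T').secondMoment ≤ B :=
        h2.trans (mul_le_mul_of_nonneg_right (Real.exp_le_exp.2 hT'.2) hS)
      rw [← (hp T' (right_mem_Icc.2 hT'.1)).1]
      exact hmem _ h3 (hdet _ h3 h1)) p₀.toPair_mem
  obtain ⟨p, hp0, hp⟩ := exists_bw_of_solution (I := Ici 0)
    (fun t ht => ⟨ht, Icc_subset_Ici_self⟩) hy0 hy
  exact ⟨p, fun t ht => ⟨_, hasBWGradientAt_klGrad hV.continuous hπ hKL _, (hp t ht).2⟩, hp0⟩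

theorem IsBWGradientFlow.hasBWTangentWithinAt (hV : Continuous V)
    (hπ : Integrable (fun x => Real.exp (-V x)) volume)
    (hKL : ∀ p : BW d, klDiv p.toMeasure (targetMeasure V) ≠ ∞) {p : ℝ → BW d}
    (hp : IsBWGradientFlow (klTo V) p) {t : ℝ} (ht : 0 ≤ t) :
    HasBWTangentWithinAt p (-klGrad V (p t).toPair) (Ici 0) t := by
  obtain ⟨g, hg, h⟩ := hp t ht
  rwa [hg.eq (hasBWGradientAt_klGrad hV hπ hKL (p t))] at h

theorem HasBWTangentWithinAt.mono {p : ℝ → BW d} {v : TangentPair d} {s s' : Set ℝ} {t : ℝ}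
    (h : HasBWTangentWithinAt p v s t) (hs : s' ⊆ s) : HasBWTangentWithinAt p v s' t :=
  ⟨h.1, h.2.1.mono hs, fun i j => (h.2.2 i j).mono hs⟩

/-- Uniqueness of the flow, from that of the integral curves of `klField`. -/
theorem IsBWGradientFlow.unique (hV : Continuous V)
    (hπ : Integrable (fun x => Real.exp (-V x)) volume)
    (hKL : ∀ p : BW d, klDiv p.toMeasure (targetMeasure V) ≠ ∞) {p q : ℝ → BW d}
    (hp : IsBWGradientFlow (klTo V) p) (hq : IsBWGradientFlow (klTo V) q) (h0 : p 0 = q 0)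
    {t : ℝ} (ht : 0 ≤ t) : p t = q t := by
  have key : ∀ {p : ℝ → BW d}, IsBWGradientFlow (klTo V) p → ∀ s ∈ Icc 0 t,
      (p s).toPair ∈ paramDomain d ∧ HasDerivWithinAt (fun τ => (p τ).toPair)
        (klField V (p s).toPair) (Icc 0 t) s := fun hp s hs => by
    refine ⟨BW.toPair_mem _, ?_⟩
    rw [klField_toPair]
    exact ((hp.hasBWTangentWithinAt hV hπ hKL
      hs.1).mono Icc_subset_Ici_self).hasDerivWithinAt_toPair
  have := ODE_solution_unique_of_contDiffOn isOpen_paramDomain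
    (contDiffOn_klField hV fun p => integrable_potential hπ (hKL p)) (key hp) (key hq)
    (congrArg BW.toPair h0) (right_mem_Icc.2 ht)
  exact BW.ext (congrArg Prod.fst this) (congrArg Prod.snd this)

end Flow

/-! ### Continuity of the Wasserstein distance between Gaussians -/

section Continuity

open Filter Topology

variable {d : ℕ}

/-- The squared distance of Gaussians to a fixed Gaussian is continuous in mean and covariance. -/
theorem tendsto_toReal_W₂_sq {ι : Type*} {l : Filter ι} {p : ι → BW d} {p₀ : BW d}
    (hp : Tendsto (fun i => (p i).toPair) l (𝓝 p₀.toPair)) (q : BW d) :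
    Tendsto (fun i => (W₂ (p i).toMeasure q.toMeasure).toReal ^ 2) l
      (𝓝 ((W₂ p₀.toMeasure q.toMeasure).toReal ^ 2)) := by
  have hm : Tendsto (fun i => (p i).mean) l (𝓝 p₀.mean) :=
    (continuous_fst.tendsto p₀.toPair).comp hp
  have hc : Tendsto (fun i => (p i).cov) l (𝓝 p₀.cov) :=
    (continuous_snd.tendsto p₀.toPair).comp hp
  -- Up to continuous terms the squared distance is minus `f`, an infimum over the positive definite
  -- `A` of the affine functions `c A`.
  set c : Matrix (Fin d) (Fin d) ℝ → BW d → ℝ := fun A r => (A * r.cov).trace + (A⁻¹ * q.cov).trace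
    with hcdef
  set f : BW d → ℝ := fun r => ‖r.mean - q.mean‖ ^ 2 + r.cov.trace + q.cov.trace -
    (W₂ r.toMeasure q.toMeasure).toReal ^ 2 with hf
  have hdual : ∀ A r, dualCost A r q =
      ‖r.mean - q.mean‖ ^ 2 + r.cov.trace + q.cov.trace - c A r := fun A r => by
    simp only [dualCost, hcdef, Matrix.sub_mul, one_mul, Matrix.trace_sub]
    ring
  have hfle : ∀ {A : Matrix (Fin d) (Fin d) ℝ}, A.PosDef → ∀ r, f r ≤ c A r := fun hA r => by
    have := dualCost_le hA r q
    rw [hdual] at this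
    simp only [hf]
    linarith
  have hfeq : ∀ r : BW d, ∃ A : Matrix (Fin d) (Fin d) ℝ, A.PosDef ∧ f r = c A r := fun r => by
    obtain ⟨A, hA, h⟩ := exists_posDef_transport r.cov_posDef q.cov_posDef
    refine ⟨A, hA, ?_⟩
    simp only [hf]
    rw [toReal_W₂_sq_eq_of_transport hA h, hdual]
    ring
  have hlim : Tendsto (fun i => f (p i)) l (𝓝 (f p₀)) := by
    refine tendsto_order.2 ⟨fun b hb => ?_, fun b hb => ?_⟩
    · have h0 : 0 ≤ f p₀ := by
        obtain ⟨A, hA, h⟩ := hfeq p₀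
        rw [h]
        exact add_nonneg (trace_mul_nonneg hA.posSemidef p₀.cov_posDef.posSemidef)
          (trace_mul_nonneg hA.inv.posSemidef q.cov_posDef.posSemidef)
      obtain ⟨ε, ⟨hε0, hε1⟩, hε⟩ : ∃ ε ∈ Ioo (0 : ℝ) 1, b < (1 - ε) * f p₀ := by
        have hcont : Tendsto (fun ε : ℝ => (1 - ε) * f p₀) (𝓝[>] 0) (𝓝 (f p₀)) := by
          have : Continuous fun ε : ℝ => (1 - ε) * f p₀ := by fun_prop
          simpa using (this.tendsto 0).mono_left nhdsWithin_le_nhds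
        have hIoo : ∀ᶠ ε in 𝓝[>] (0 : ℝ), ε ∈ Ioo (0 : ℝ) 1 := Ioo_mem_nhdsGT zero_lt_one
        exact (hIoo.and (hcont.eventually (lt_mem_nhds hb))).exists
      -- If `Σ_i ≥ (1 - ε) Σ₀` then `c A (p i) ≥ (1 - ε) c A p₀` for all `A` simultaneously.
      have hpos : p₀.cov - (1 - ε) • p₀.cov ∈ posForm d := by
        rw [sub_smul, one_smul, sub_sub_cancel]
        exact (p₀.cov_posDef.smul hε0).mem_posForm
      filter_upwards [(hc.sub_const ((1 - ε) • p₀.cov)).eventually (isOpen_posForm.mem_nhds hpos)]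
        with i hi
      have hps := (posDef_of_mem_posForm
        ((p i).cov_posDef.isSymm.sub (p₀.cov_posDef.isSymm.smul (1 - ε))) hi).posSemidef
      obtain ⟨A, hA, h⟩ := hfeq (p i)
      have h1 := trace_mul_nonneg hA.posSemidef hps
      rw [Matrix.mul_sub, Matrix.mul_smul, Matrix.trace_sub, Matrix.trace_smul, smul_eq_mul] at h1
      have h2 := trace_mul_nonneg hA.inv.posSemidef q.cov_posDef.posSemidef
      have h3 := mul_le_mul_of_nonneg_left (hfle hA p₀) (sub_nonneg.2 hε1.le)
      rw [h]
      simp only [hcdef] at h3 ⊢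
      nlinarith
    · obtain ⟨A, hA, h⟩ := hfeq p₀
      have hcA : Tendsto (fun i => c A (p i)) l (𝓝 (c A p₀)) := by
        have : Continuous fun M : Matrix (Fin d) (Fin d) ℝ =>
          (A * M).trace + (A⁻¹ * q.cov).trace := by fun_prop
        exact (this.tendsto p₀.cov).comp hc
      rw [h] at hb
      filter_upwards [hcA.eventually (gt_mem_nhds hb)] with i hi
      exact (hfle hA _).trans_lt hi
  have hrest : Tendsto (fun i => ‖(p i).mean - q.mean‖ ^ 2 + (p i).cov.trace + q.cov.trace) l
      (𝓝 (‖p₀.mean - q.mean‖ ^ 2 + p₀.cov.trace + q.cov.trace)) := by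
    have htr : Continuous fun M : Matrix (Fin d) (Fin d) ℝ => M.trace := by fun_prop
    exact ((((hm.sub_const _).norm).pow 2).add ((htr.tendsto _).comp hc)).add_const _
  simpa [hf] using hrest.sub hlim

end Continuity

/-! ### Convergence rates -/

section Rates

open Filter Topology

variable {d : ℕ} {V : EuclideanSpace ℝ (Fin d) → ℝ} {α : ℝ}

attribute [local instance] Matrix.normedAddCommGroup Matrix.normedSpace

theorem HasBWTangentWithinAt.hasDerivWithinAt_dualCost {p : ℝ → BW d} {v : TangentPair d}
    {s : Set ℝ} {t : ℝ} (h : HasBWTangentWithinAt p v s t) {A : Matrix (Fin d) (Fin d) ℝ}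
    (hA : A.IsSymm) (q : BW d) :
    HasDerivWithinAt (fun τ => dualCost A (p τ) q)
      (-(2 * bwInner (p t) v (q.mean - (p t).mean, A - 1))) s t := by
  have h1 := (h.2.1.sub_const q.mean).norm_sq
  have h2 : HasDerivWithinAt (fun τ => ((1 - A) * (p τ).cov).trace)
      ((1 - A) * (v.2 * (p t).cov + (p t).cov * v.2)).trace s t := by
    simp only [Matrix.trace, Matrix.diag, Matrix.mul_apply (M := 1 - A)]
    exact HasDerivWithinAt.fun_sum fun i _ => HasDerivWithinAt.fun_sum fun j _ =>
      (h.2.2 j i).const_mul _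
  refine ((h1.add h2).add_const _).congr_deriv ?_
  have hB : (1 - A)ᵀ = 1 - A := (Matrix.isSymm_one.sub hA).eq
  have h3 : ((1 - A) * (v.2 * (p t).cov)).trace = ((1 - A) * ((p t).cov * v.2)).trace := by
    rw [← Matrix.trace_transpose, Matrix.transpose_mul, Matrix.transpose_mul, hB, h.1.eq,
      (p t).cov_posDef.isSymm.eq, Matrix.trace_mul_comm]
  have h4 : (v.2 * ((p t).cov * (A - 1))).trace = -((1 - A) * (v.2 * (p t).cov)).trace := by
    rw [← mul_assoc, Matrix.trace_mul_comm, ← neg_sub 1 A, Matrix.neg_mul, Matrix.trace_neg]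
  have h5 : (inner ℝ v.1 (q.mean - (p t).mean) : ℝ) = -inner ℝ ((p t).mean - q.mean) v.1 := by
    rw [real_inner_comm, ← neg_sub, inner_neg_left]
  rw [bwInner, h.1.eq, Matrix.mul_add, Matrix.trace_add, ← h3]
  dsimp only
  rw [h4, h5]
  ring

/-- The evolution variational inequality, in the form of a function that touches the squared
distance to `q` from below: the optimal transport map at time `t` stays feasible in the dual
problem at all times. -/
theorem IsBWGradientFlow.exists_touching (hV : ContDiff ℝ 2 V)
    (hπ : Integrable (fun x => Real.exp (-V x)) volume)
    (hKL : ∀ p : BW d, klDiv p.toMeasure (targetMeasure V) ≠ ∞)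
    (hα : ∀ x v : EuclideanSpace ℝ (Fin d), α * ‖v‖ ^ 2 ≤ fderiv ℝ (fderiv ℝ V) x v v)
    {p : ℝ → BW d} (hp : IsBWGradientFlow (klTo V) p) (q : BW d) {t : ℝ} (ht : 0 ≤ t) :
    ∃ φ : ℝ → ℝ, ∃ φ' ≤ 2 * (klTo V q - klTo V (p t)) -
        α * (W₂ (p t).toMeasure q.toMeasure).toReal ^ 2,
      φ t = (W₂ (p t).toMeasure q.toMeasure).toReal ^ 2 ∧
      (∀ s, φ s ≤ (W₂ (p s).toMeasure q.toMeasure).toReal ^ 2) ∧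
      HasDerivWithinAt φ φ' (Ici 0) t := by
  obtain ⟨A, hA, h⟩ := exists_posDef_transport (p t).cov_posDef q.cov_posDef
  refine ⟨fun s => dualCost A (p s) q, _, ?_, (toReal_W₂_sq_eq_of_transport hA h).symm,
    fun s => dualCost_le hA _ _, (hp.hasBWTangentWithinAt hV.continuous hπ hKL
      ht).hasDerivWithinAt_dualCost hA.isSymm q⟩
  have := bwInner_klGrad_le hV hπ hKL hα hA h
  rw [bwInner_comm, bwInner_neg_right, bwInner_comm]
  linarith

theorem IsBWGradientFlow.continuousOn_W₂_sq (hV : Continuous V)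
    (hπ : Integrable (fun x => Real.exp (-V x)) volume)
    (hKL : ∀ p : BW d, klDiv p.toMeasure (targetMeasure V) ≠ ∞)
    {p : ℝ → BW d} (hp : IsBWGradientFlow (klTo V) p) (q : BW d) :
    ContinuousOn (fun t => (W₂ (p t).toMeasure q.toMeasure).toReal ^ 2) (Ici 0) := fun _ ht =>
  tendsto_toReal_W₂_sq
    (hp.hasBWTangentWithinAt hV hπ hKL ht).hasDerivWithinAt_toPair.continuousWithinAt q

/-- The quadratic growth of an `α`-convex functional away from its minimizer. -/
theorem mul_W₂_sq_le_of_isMin (hV : ContDiff ℝ 2 V)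
    (hπ : Integrable (fun x => Real.exp (-V x)) volume)
    (hKL : ∀ p : BW d, klDiv p.toMeasure (targetMeasure V) ≠ ∞)
    (hα : ∀ x v : EuclideanSpace ℝ (Fin d), α * ‖v‖ ^ 2 ≤ fderiv ℝ (fderiv ℝ V) x v v)
    {q : BW d} (hq : ∀ p, klTo V q ≤ klTo V p) (p : BW d) :
    α / 2 * (W₂ p.toMeasure q.toMeasure).toReal ^ 2 ≤ klTo V p - klTo V q := by
  obtain ⟨A, hA, h⟩ := exists_posDef_transport p.cov_posDef q.cov_posDef
  -- Compare the minimizer with the point at time `s` of the geodesic that ends in it, as `s → 1`.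
  have hlim : Tendsto (fun s : ℝ => α / 2 * (W₂ p.toMeasure q.toMeasure).toReal ^ 2 * s) (𝓝[<] 1)
      (𝓝 (α / 2 * (W₂ p.toMeasure q.toMeasure).toReal ^ 2)) := by
    have : Continuous fun s : ℝ => α / 2 * (W₂ p.toMeasure q.toMeasure).toReal ^ 2 * s := by
      fun_prop
    simpa using (this.tendsto 1).mono_left nhdsWithin_le_nhds
  refine le_of_tendsto hlim ?_
  filter_upwards [Ioo_mem_nhdsLT (zero_lt_one' ℝ)] with s hs
  have h1 := klTo_geodesic_le hV hπ hKL hα hA h (Ioo_subset_Icc_self hs)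
  have h2 := hq (p.geodesic q.mean hA (Ioo_subset_Icc_self hs))
  have h3 : 0 < 1 - s := sub_pos.2 hs.2
  refine le_of_mul_le_mul_left ?_ h3
  linarith

theorem hasDerivAt_exp_mul (c t : ℝ) :
    HasDerivAt (fun t => Real.exp (c * t)) (c * Real.exp (c * t)) t := by
  simpa [mul_comm] using ((hasDerivAt_id t).const_mul c).exp

/-- Contraction towards a minimizer: the evolution variational inequality together with quadratic
growth gives `D' ≤ -2 α D` for the squared distance `D`. -/
theorem IsBWGradientFlow.W₂_sq_le (hV : ContDiff ℝ 2 V)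
    (hπ : Integrable (fun x => Real.exp (-V x)) volume)
    (hKL : ∀ p : BW d, klDiv p.toMeasure (targetMeasure V) ≠ ∞)
    (hα : ∀ x v : EuclideanSpace ℝ (Fin d), α * ‖v‖ ^ 2 ≤ fderiv ℝ (fderiv ℝ V) x v v)
    {p : ℝ → BW d} (hp : IsBWGradientFlow (klTo V) p) {q : BW d}
    (hq : ∀ p, klTo V q ≤ klTo V p) {T : ℝ} (hT : 0 ≤ T) :
    Real.exp (2 * α * T) * (W₂ (p T).toMeasure q.toMeasure).toReal ^ 2 ≤
      (W₂ (p 0).toMeasure q.toMeasure).toReal ^ 2 := by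
  have hcont : ContinuousOn (fun t => Real.exp (2 * α * t) *
      (W₂ (p t).toMeasure q.toMeasure).toReal ^ 2) (Icc 0 T) :=
    ContinuousOn.mul (by fun_prop)
      ((hp.continuousOn_W₂_sq hV.continuous hπ hKL q).mono Icc_subset_Ici_self)
  have := le_of_touching_from_below hT hcont fun t ht => by
    obtain ⟨φ, φ', hφ', hφt, hφ, hd⟩ := hp.exists_touching hV hπ hKL hα q ht.1.le
    refine ⟨fun s => Real.exp (2 * α * s) * φ s, _, ?_, by dsimp only; rw [hφt], fun s _ =>
      mul_le_mul_of_nonneg_left (hφ s) (Real.exp_pos _).le,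
      (hasDerivAt_exp_mul (2 * α) t).hasDerivWithinAt.mul (hd.mono Icc_subset_Ici_self)⟩
    have h1 := mul_W₂_sq_le_of_isMin hV hπ hKL hα hq (p t)
    have h2 : 2 * α * φ t + φ' ≤ 0 := by
      rw [hφt]
      linarith
    have := mul_nonpos_of_nonneg_of_nonpos (Real.exp_pos (2 * α * t)).le h2
    linarith
  simpa using this

/-- In the convex case `D(t) + 2 t (F(p_t) - F(q))` is nonincreasing, for `D` the squared distance
to `q` and `F` the divergence. -/
theorem IsBWGradientFlow.two_mul_klTo_sub_le (hV : ContDiff ℝ 2 V)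
    (hπ : Integrable (fun x => Real.exp (-V x)) volume)
    (hKL : ∀ p : BW d, klDiv p.toMeasure (targetMeasure V) ≠ ∞)
    (hα : ∀ x v : EuclideanSpace ℝ (Fin d), 0 * ‖v‖ ^ 2 ≤ fderiv ℝ (fderiv ℝ V) x v v)
    {p : ℝ → BW d} (hp : IsBWGradientFlow (klTo V) p) (q : BW d) {T : ℝ} (hT : 0 ≤ T) :
    2 * T * (klTo V (p T) - klTo V q) ≤ (W₂ (p 0).toMeasure q.toMeasure).toReal ^ 2 := by
  have hF : ∀ t ∈ Icc 0 T, HasDerivWithinAt (fun t => klTo V (p t))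
      (-bwInner (p t) (klGrad V (p t).toPair) (klGrad V (p t).toPair)) (Icc 0 T) t := fun t ht =>
    (hasDerivWithinAt_klTo_flow hV.continuous hπ hKL
      (hp.hasBWTangentWithinAt hV.continuous hπ hKL ht.1)).mono Icc_subset_Ici_self
  have hcont : ContinuousOn (fun t => (W₂ (p t).toMeasure q.toMeasure).toReal ^ 2 +
      2 * t * (klTo V (p t) - klTo V q)) (Icc 0 T) := by
    refine ((hp.continuousOn_W₂_sq hV.continuous hπ hKL q).mono Icc_subset_Ici_self).add
      (ContinuousOn.mul (by fun_prop) (ContinuousOn.sub (fun t ht => ?_) continuousOn_const))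
    exact (hF t ht).continuousWithinAt
  have := le_of_touching_from_below hT hcont fun t ht => by
    obtain ⟨φ, φ', hφ', hφt, hφ, hd⟩ := hp.exists_touching hV hπ hKL hα q ht.1.le
    have hlin : HasDerivAt (fun s : ℝ => 2 * s) 2 t := by
      simpa using (hasDerivAt_id t).const_mul (2 : ℝ)
    refine ⟨fun s => φ s + 2 * s * (klTo V (p s) - klTo V q), _, ?_, by dsimp only; rw [hφt],
      fun s _ => add_le_add_left (hφ s) _, (hd.mono Icc_subset_Ici_self).add
        (hlin.hasDerivWithinAt.mul (((hF t (Ioc_subset_Icc_self ht)).mono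
          (Icc_subset_Icc_right ht.2)).sub_const _))⟩
    have h1 := mul_nonneg ht.1.le (bwInner_self_nonneg (p t) (klGrad V (p t).toPair))
    linarith
  simp only [mul_zero, zero_mul, add_zero] at this
  have h2 := sq_nonneg (W₂ (p T).toMeasure q.toMeasure).toReal
  linarith

/-- The Polyak-Łojasiewicz inequality: the defect of the tangent inequality is bounded by
its extremal value over all tangent vectors. -/
theorem polyak_lojasiewicz (hV : ContDiff ℝ 2 V)
    (hπ : Integrable (fun x => Real.exp (-V x)) volume)
    (hKL : ∀ p : BW d, klDiv p.toMeasure (targetMeasure V) ≠ ∞)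
    (hα : ∀ x v : EuclideanSpace ℝ (Fin d), α * ‖v‖ ^ 2 ≤ fderiv ℝ (fderiv ℝ V) x v v)
    (hα0 : 0 < α) (p q : BW d) :
    2 * α * (klTo V p - klTo V q) ≤ bwInner p (klGrad V p.toPair) (klGrad V p.toPair) := by
  obtain ⟨A, hA, h⟩ := exists_posDef_transport p.cov_posDef q.cov_posDef
  have h1 := bwInner_klGrad_le hV hπ hKL hα hA h
  rw [toReal_W₂_sq_eq_of_transport hA h, dualCost_eq_of_transport hA h] at h1
  have h2 := bwInner_quadratic_nonneg p (klGrad V p.toPair) (q.mean - p.mean, A - 1) α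
  have h3 := mul_le_mul_of_nonneg_left h1 hα0.le
  nlinarith

theorem IsBWGradientFlow.klTo_sub_le (hV : ContDiff ℝ 2 V)
    (hπ : Integrable (fun x => Real.exp (-V x)) volume)
    (hKL : ∀ p : BW d, klDiv p.toMeasure (targetMeasure V) ≠ ∞)
    (hα : ∀ x v : EuclideanSpace ℝ (Fin d), α * ‖v‖ ^ 2 ≤ fderiv ℝ (fderiv ℝ V) x v v)
    (hα0 : 0 < α) {p : ℝ → BW d} (hp : IsBWGradientFlow (klTo V) p) (q : BW d)
    {T : ℝ} (hT : 0 ≤ T) :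
    Real.exp (2 * α * T) * (klTo V (p T) - klTo V q) ≤ klTo V (p 0) - klTo V q := by
  have := le_of_hasDerivWithinAt_nonpos hT
    (f := fun t => Real.exp (2 * α * t) * (klTo V (p t) - klTo V q))
    (fun t ht => (hasDerivAt_exp_mul (2 * α) t).hasDerivWithinAt.mul
      (((hasDerivWithinAt_klTo_flow hV.continuous hπ hKL
        (hp.hasBWTangentWithinAt hV.continuous hπ hKL ht.1)).mono
          Icc_subset_Ici_self).sub_const _)) fun t ht => by
    have h1 := sub_nonpos.2 (polyak_lojasiewicz hV hπ hKL hα hα0 (p t) q)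
    have := mul_nonpos_of_nonneg_of_nonpos (Real.exp_pos (2 * α * t)).le h1
    linarith
  simpa using this

end Rates

theorem corollary1 {d : ℕ} (V : EuclideanSpace ℝ (Fin d) → ℝ) (α : ℝ)
    (hV : ContDiff ℝ 2 V)
    (hπ : Integrable (fun x => Real.exp (-V x)) volume)
    (hKL : ∀ p : BW d, klDiv p.toMeasure (targetMeasure V) ≠ ∞)
    (hα : ∀ x v : EuclideanSpace ℝ (Fin d), α * ‖v‖ ^ 2 ≤ fderiv ℝ (fderiv ℝ V) x v v)
    (p₀ : BW d) :
    ∃ p : ℝ → BW d,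
      -- `p` is a gradient flow started at `p₀`
      (IsBWGradientFlow (klTo V) p ∧ p 0 = p₀) ∧
      -- it is the only one
      (∀ q : ℝ → BW d, IsBWGradientFlow (klTo V) q → q 0 = p₀ → ∀ t, 0 ≤ t → q t = p t) ∧
      -- convergence to the minimizer of the divergence over the Gaussians
      (∀ πhat : BW d, (∀ q : BW d, klTo V πhat ≤ klTo V q) →
        (0 < α → ∀ t, 0 ≤ t →
          W₂ (p t).toMeasure πhat.toMeasure ^ 2 ≤
            ENNReal.ofReal (Real.exp (-2 * α * t)) * W₂ p₀.toMeasure πhat.toMeasure ^ 2) ∧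
        (0 < α → ∀ t, 0 ≤ t →
          klTo V (p t) - klTo V πhat ≤
            Real.exp (-2 * α * t) * (klTo V p₀ - klTo V πhat)) ∧
        (α = 0 → ∀ t, 0 < t →
          klTo V (p t) - klTo V πhat ≤
            1 / (2 * t) * (W₂ p₀.toMeasure πhat.toMeasure).toReal ^ 2)) := by
  obtain ⟨p, hp, rfl⟩ := exists_gradientFlow hV hπ hKL hα p₀
  have hexp : ∀ {a b t : ℝ}, Real.exp (2 * α * t) * a ≤ b → a ≤ Real.exp (-2 * α * t) * b := by
    intro a b t h
    have := mul_le_mul_of_nonneg_left h (Real.exp_pos (-2 * α * t)).le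
    rwa [← mul_assoc, ← Real.exp_add, ← add_mul, neg_mul, neg_add_cancel, zero_mul, Real.exp_zero,
      one_mul, ← neg_mul] at this
  refine ⟨p, ⟨hp, rfl⟩, fun q hq h0 t ht => hq.unique hV.continuous hπ hKL hp h0 ht,
    fun q hq => ⟨fun hα0 t ht => ?_, fun hα0 t ht => ?_, ?_⟩⟩
  · have h := hexp (hp.W₂_sq_le hV hπ hKL hα hq ht)
    have htop := W₂_ne_top (p 0) q
    refine (ENNReal.toReal_le_toReal (ENNReal.pow_ne_top (W₂_ne_top _ _))
      (ENNReal.mul_ne_top ENNReal.ofReal_ne_top (ENNReal.pow_ne_top htop))).1 ?_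
    rwa [ENNReal.toReal_mul, ENNReal.toReal_pow, ENNReal.toReal_pow,
      ENNReal.toReal_ofReal (Real.exp_pos _).le]
  · exact hexp (hp.klTo_sub_le hV hπ hKL hα hα0 q ht)
  · rintro rfl t ht
    have h := hp.two_mul_klTo_sub_le hV hπ hKL hα q ht.le
    rw [one_div, inv_mul_eq_div, le_div_iff₀ (by positivity)]
    linarith
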